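/- Let $d\in\mathbb N$ and $\hbar>0$. On $\mathbb R^d$ put $\mathcal F h(\xi)=(2\pi\hbar)^{-d/2}\int e^{-\frac{i}{\hbar}\xi\cdot x}h(x)\,dx$, extended to tempered distributions by transposition. For Schwartz functions put $\langle \gamma,g\rangle=\int\gamma\,\overline{g}$, and for $f\in\mathcal S'(\mathbb R^d)$, $g\in\mathcal S(\mathbb R^d)$ put $\langle f,g\rangle=f(\overline g)$. Let $\pi(x,\xi)g(y)=(2\pi\hbar)^{-d/2}e^{\frac{i}{\hbar}\xi\cdot y}g(y-x)$, and for $f\in\mathcal S'(\mathbb R^d)$ and $g\in\mathcal S(\mathbb R^d)$ let $$V_gf(x,\xi)=\langle f,\pi(x,\xi)g\rangle,\qquad \mathcal V_gf(x,\xi)=\overline{V_g\overline f(x,\xi)},\qquad (x,\xi)\in\mathbb R^{2d}.$$ Let $M^{\infty,1}(\mathbb R^d)$ be the set of $h\in\mathcal S'(\mathbb R^d)$ such that $\int_{\mathbb R^d}\sup_{x\in\mathbb R^d}|V_gh(x,\xi)|\,d\xi<\infty$ for some $g\in\mathcal S(\mathbb R^d)\setminus\{0\}$, and let $W^{\infty,1}(\mathbb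 R^d)=\mathcal FM^{\infty,1}(\mathbb R^d)$. Let $F_+(x)=(2\pi i\hbar)^{-d/2}e^{\frac{i}{2\hbar}|x|^2}$ (principal branch), and $\varphi_\varepsilon(y)=\varphi(\varepsilon y)$. **Theorem.** Let $f\in W^{\infty,1}(\mathbb R^d)$. Then $f$ is Fresnel integrable in the following sense: for all $\varphi,g,\gamma\in\mathcal S(\mathbb R^d)$ with $\varphi(0)=1$ and $\langle\gamma,g\rangle\neq0$, the integral below converges absolutely for every $\varepsilon>0$, and the limit $$\widetilde{\int_{\mathbb R^d}}^{*}e^{\frac{i}{2\hbar}|x|^2}f(x)\,dx:=\lim_{\varepsilon\downarrow0}\frac1{\langle\gamma,g\rangle}\int_{\mathbb R^{2d}}V_gF_+(x,\xi)\,\mathcal V_\gamma(f\varphi_\varepsilon)(x,\xi)\,dx\,d\xi$$ exists and does not depend on $\varphi$, $g$, $\gamma$. Moreover, for all $g,\gamma\in\mathcal S(\mathbb R^d)$ with $\langle\gamma,g\rangle\neq0$, $$\widetilde{\int_{\mathbb R^d}}^{*}e^{\frac{i}{2\hbar}|x|^2}f(x)\,dx=\frac1{\langle\gamma,g\rangle}\int_{\mathbb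 R^{2d}}V_gF_+(x,\xi)\,\mathcal V_\gamma f(x,\xi)\,dx\,d\xi,$$ where the last integral converges absolutely. -/

import Mathlib

open MeasureTheory Filter Topology
open scoped SchwartzMap FourierTransform ENNReal

namespace FresnelGabor

noncomputable section

/-- `ℝ^d` with its Euclidean structure. -/
abbrev Rd (d : ℕ) : Type := EuclideanSpace ℝ (Fin d)

/-! ### Temperate growth of the functions used as multipliers -/

theorem hasTemperateGrowth_exp_I :
    Function.HasTemperateGrowth (fun t : ℝ => Complex.exp (t * Complex.I)) := by
  have hder : ∀ n : ℕ, iteratedDeriv n (fun t : ℝ => Complex.exp (t * Complex.I)) =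
      fun t : ℝ => Complex.I ^ n * Complex.exp (t * Complex.I) := by
    intro n
    induction n with
    | zero => simp
    | succ n ih =>
      rw [iteratedDeriv_succ, ih]
      funext t
      have h1 : HasDerivAt (fun t : ℝ => (t : ℂ) * Complex.I) (1 * Complex.I) t :=
        (Complex.ofRealCLM.hasDerivAt (x := t)).mul_const Complex.I
      have h2 := (h1.cexp).const_mul (Complex.I ^ n)
      rw [h2.deriv]
      ring
  refine ⟨(Complex.ofRealCLM.contDiff.mul contDiff_const).cexp, fun n => ⟨0, 1, fun t => ?_⟩⟩
  rw [norm_iteratedFDeriv_eq_norm_iteratedDeriv, hder n]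
  simp [Complex.norm_exp_ofReal_mul_I]

theorem hasTemperateGrowth_exp_I_comp {d : ℕ} {u : Rd d → ℝ} (hu : u.HasTemperateGrowth) :
    Function.HasTemperateGrowth (fun y : Rd d => Complex.exp (u y * Complex.I)) :=
  hasTemperateGrowth_exp_I.comp hu

/-- The character `y ↦ exp(i ξ·y/ħ)`. -/
def character {d : ℕ} (ħ : ℝ) (ξ : Rd d) (y : Rd d) : ℂ :=
  Complex.exp (((ħ⁻¹ * inner ℝ ξ y : ℝ) : ℂ) * Complex.I)

theorem hasTemperateGrowth_character {d : ℕ} (ħ : ℝ) (ξ : Rd d) :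
    (character ħ ξ).HasTemperateGrowth := by
  apply hasTemperateGrowth_exp_I_comp
  exact (Function.HasTemperateGrowth.const ħ⁻¹).mul
    (Function.hasTemperateGrowth_inner_right ξ)

/-! ### Schwartz functions: pairing, conjugation, phase space shifts, Fourier transform -/

/-- `⟨g, h⟩ = ∫ g(y) conj(h(y)) dy`. -/
def schwartzInner {d : ℕ} (g h : 𝓢(Rd d, ℂ)) : ℂ :=
  ∫ y, g y * (starRingEnd ℂ) (h y)

/-- The complex conjugate of a Schwartz function. -/
def conjS {d : ℕ} (g : 𝓢(Rd d, ℂ)) : 𝓢(Rd d, ℂ) :=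
  SchwartzMap.postcompCLM (𝕜 := ℝ) (Complex.conjCLE : ℂ →L[ℝ] ℂ) g

@[simp]
theorem conjS_apply {d : ℕ} (g : 𝓢(Rd d, ℂ)) (y : Rd d) :
    conjS g y = (starRingEnd ℂ) (g y) := rfl

/-- The constant `(2πħ)^{-d/2}`. -/
def normConst (d : ℕ) (ħ : ℝ) : ℝ := (2 * Real.pi * ħ) ^ (-(d : ℝ) / 2)

/-- The phase space shift `π(x, ξ) = M_ξ T_x` on Schwartz functions. -/
def phaseShift {d : ℕ} (ħ : ℝ) (x ξ : Rd d) (g : 𝓢(Rd d, ℂ)) : 𝓢(Rd d, ℂ) :=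
  (normConst d ħ : ℂ) •
    SchwartzMap.smulLeftCLM ℂ (character ħ ξ) (SchwartzMap.compSubConstCLM ℂ x g)

theorem phaseShift_apply {d : ℕ} (ħ : ℝ) (x ξ : Rd d) (g : 𝓢(Rd d, ℂ)) (y : Rd d) :
    phaseShift ħ x ξ g y = (normConst d ħ : ℂ) * (character ħ ξ y * g (y - x)) := by
  simp [phaseShift, SchwartzMap.smulLeftCLM_apply_apply (hasTemperateGrowth_character ħ ξ)]

theorem two_pi_mul_inv_ne_zero {ħ : ℝ} (hħ : 0 < ħ) : (2 * Real.pi * ħ)⁻¹ ≠ 0 := by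
  positivity

/-- The dilation `ξ ↦ (2πħ)⁻¹ ξ` of `ℝ^d`. -/
def dilationEquiv (d : ℕ) {ħ : ℝ} (hħ : 0 < ħ) : Rd d ≃L[ℝ] Rd d :=
  ContinuousLinearEquiv.smulLeft (Units.mk0 (2 * Real.pi * ħ)⁻¹ (two_pi_mul_inv_ne_zero hħ))

/-- The Fourier transform with parameter `ħ` on Schwartz functions, obtained by rescaling
Mathlib's Fourier transform; see `fourierS_apply` for the integral formula. -/
def fourierS (d : ℕ) {ħ : ℝ} (hħ : 0 < ħ) : 𝓢(Rd d, ℂ) →L[ℂ] 𝓢(Rd d, ℂ) :=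
  (normConst d ħ : ℂ) •
    (SchwartzMap.compCLMOfContinuousLinearEquiv ℂ (dilationEquiv d hħ) ∘L
      FourierTransform.fourierCLM ℂ 𝓢(Rd d, ℂ))

theorem fourierS_apply {d : ℕ} {ħ : ℝ} (hħ : 0 < ħ) (g : 𝓢(Rd d, ℂ)) (ξ : Rd d) :
    fourierS d hħ g ξ = (normConst d ħ : ℂ) *
      ∫ x, Complex.exp (-(Complex.I / ħ) * (inner ℝ ξ x : ℝ)) * g x := by
  have h0 : (ħ : ℂ) ≠ 0 := by exact_mod_cast hħ.ne'
  have hpi : (Real.pi : ℂ) ≠ 0 := by exact_mod_cast Real.pi_ne_zero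
  have h1 : fourierS d hħ g ξ =
      (normConst d ħ : ℂ) * 𝓕 (g : Rd d → ℂ) ((2 * Real.pi * ħ)⁻¹ • ξ) := rfl
  rw [h1, Real.fourier_eq']
  congr 1
  refine integral_congr_ae (Eventually.of_forall fun x => ?_)
  simp only [smul_eq_mul]
  congr 2
  rw [real_inner_smul_right, real_inner_comm]
  push_cast
  field_simp

/-! ### Tempered distributions -/

/-- The complex conjugate of a tempered distribution, `conj(f)(φ) = conj(f(conj(φ)))`. -/
def conjD {d : ℕ} (f : 𝓢'(Rd d, ℂ)) : 𝓢'(Rd d, ℂ) :=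
  ContinuousLinearMap.toPointwiseConvergenceCLM _ _ _ _
    { toFun := fun φ => (starRingEnd ℂ) (f (conjS φ))
      map_add' := fun φ ψ => by
        have : conjS (φ + ψ) = conjS φ + conjS ψ := by ext y; simp
        simp [this]
      map_smul' := fun c φ => by
        have : conjS (c • φ) = (starRingEnd ℂ) c • conjS φ := by ext y; simp
        simp [this]
      cont := by
        have h1 : Continuous (fun φ : 𝓢(Rd d, ℂ) => conjS φ) :=
          (SchwartzMap.postcompCLM (𝕜 := ℝ) (Complex.conjCLE : ℂ →L[ℝ] ℂ)).continuous
        exact Complex.continuous_conj.comp (f.continuous.comp h1) }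

@[simp]
theorem conjD_apply {d : ℕ} (f : 𝓢'(Rd d, ℂ)) (φ : 𝓢(Rd d, ℂ)) :
    conjD f φ = (starRingEnd ℂ) (f (conjS φ)) := rfl

/-- The Fourier transform with parameter `ħ` on tempered distributions, by transposition. -/
def fourierD (d : ℕ) {ħ : ℝ} (hħ : 0 < ħ) : 𝓢'(Rd d, ℂ) →L[ℂ] 𝓢'(Rd d, ℂ) :=
  PointwiseConvergenceCLM.precomp ℂ (fourierS d hħ)

@[simp]
theorem fourierD_apply {d : ℕ} {ħ : ℝ} (hħ : 0 < ħ) (f : 𝓢'(Rd d, ℂ)) (φ : 𝓢(Rd d, ℂ)) :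
    fourierD d hħ f φ = f (fourierS d hħ φ) := rfl

/-- The Gabor transform `V_g f(x, ξ) = ⟨f, π(x, ξ) g⟩ = f(conj(π(x, ξ) g))`. -/
def gabor {d : ℕ} (ħ : ℝ) (g : 𝓢(Rd d, ℂ)) (f : 𝓢'(Rd d, ℂ)) (x ξ : Rd d) : ℂ :=
  f (conjS (phaseShift ħ x ξ g))

/-- The conjugate Gabor transform `𝒱_g f = conj(V_g (conj f))`. -/
def conjGabor {d : ℕ} (ħ : ℝ) (g : 𝓢(Rd d, ℂ)) (f : 𝓢'(Rd d, ℂ)) (x ξ : Rd d) : ℂ :=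
  (starRingEnd ℂ) (gabor ħ g (conjD f) x ξ)

theorem conjGabor_eq {d : ℕ} (ħ : ℝ) (g : 𝓢(Rd d, ℂ)) (f : 𝓢'(Rd d, ℂ)) (x ξ : Rd d) :
    conjGabor ħ g f x ξ = f (phaseShift ħ x ξ g) := by
  have h : conjS (conjS (phaseShift ħ x ξ g)) = phaseShift ħ x ξ g := by ext y; simp
  simp [conjGabor, gabor, h]

/-- `f` belongs to the modulation space `M^{∞,1}(ℝ^d)`: for some nonzero Schwartz window `g`,
`∫ sup_x |V_g f(x, ξ)| dξ < ∞`. -/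
def MemModulation {d : ℕ} (ħ : ℝ) (f : 𝓢'(Rd d, ℂ)) : Prop :=
  ∃ g : 𝓢(Rd d, ℂ), g ≠ 0 ∧ (∫⁻ ξ : Rd d, ⨆ x : Rd d, ‖gabor ħ g f x ξ‖ₑ) < ∞

/-- `f` belongs to the Wiener amalgam space `W^{∞,1}(ℝ^d) = 𝓕 M^{∞,1}(ℝ^d)`. -/
def MemWienerAmalgam {d : ℕ} {ħ : ℝ} (hħ : 0 < ħ) (f : 𝓢'(Rd d, ℂ)) : Prop :=
  ∃ h : 𝓢'(Rd d, ℂ), MemModulation ħ h ∧ f = fourierD d hħ h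

/-! ### The Fresnel function -/

/-- `F₊(x) = (2πiħ)^{-d/2} exp(i|x|²/(2ħ))`, with the principal branch of the power. -/
def fresnelFun (d : ℕ) (ħ : ℝ) (x : Rd d) : ℂ :=
  (2 * Real.pi * Complex.I * ħ) ^ (-(d : ℂ) / 2) *
    Complex.exp (((‖x‖ ^ 2 / (2 * ħ) : ℝ) : ℂ) * Complex.I)

theorem hasTemperateGrowth_fresnelFun (d : ℕ) (ħ : ℝ) :
    (fresnelFun d ħ).HasTemperateGrowth := by
  refine (Function.HasTemperateGrowth.const _).mul (hasTemperateGrowth_exp_I_comp ?_)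
  simp only [div_eq_mul_inv]
  exact (Function.hasTemperateGrowth_norm_sq (H := Rd d)).mul
    (Function.HasTemperateGrowth.const _)

/-- `F₊` as a tempered distribution. -/
def fresnelDist (d : ℕ) (ħ : ℝ) : 𝓢'(Rd d, ℂ) :=
  Function.HasTemperateGrowth.toTemperedDistribution volume (hasTemperateGrowth_fresnelFun d ħ)

theorem gabor_fresnelDist {d : ℕ} (ħ : ℝ) (g : 𝓢(Rd d, ℂ)) (x ξ : Rd d) :
    gabor ħ g (fresnelDist d ħ) x ξ =
      ∫ y, fresnelFun d ħ y * (starRingEnd ℂ) (phaseShift ħ x ξ g y) := by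
  simp [gabor, fresnelDist, mul_comm]

/-! ### Regularization and the Fresnel integral of a distribution -/

theorem hasTemperateGrowth_dilate {d : ℕ} (φ : 𝓢(Rd d, ℂ)) (ε : ℝ) :
    Function.HasTemperateGrowth (fun y : Rd d => φ (ε • y)) :=
  φ.hasTemperateGrowth.comp (ε • ContinuousLinearMap.id ℝ (Rd d)).hasTemperateGrowth

/-- The product `f φ_ε` with `φ_ε(y) = φ(εy)`. -/
def regularize {d : ℕ} (φ : 𝓢(Rd d, ℂ)) (ε : ℝ) (f : 𝓢'(Rd d, ℂ)) : 𝓢'(Rd d, ℂ) :=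
  TemperedDistribution.smulLeftCLM ℂ (fun y : Rd d => φ (ε • y)) f

theorem regularize_apply {d : ℕ} (φ : 𝓢(Rd d, ℂ)) (ε : ℝ) (f : 𝓢'(Rd d, ℂ)) (ψ χ : 𝓢(Rd d, ℂ))
    (hχ : ∀ y, χ y = φ (ε • y) * ψ y) : regularize φ ε f ψ = f χ := by
  have h : SchwartzMap.smulLeftCLM ℂ (fun y : Rd d => φ (ε • y)) ψ = χ := by
    ext y
    simp [SchwartzMap.smulLeftCLM_apply_apply (hasTemperateGrowth_dilate φ ε), hχ]
  simp [regularize, h]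

/-- The phase space integrand `(x, ξ) ↦ V_g F₊(x, ξ) 𝒱_γ f(x, ξ)`. -/
def phaseIntegrand {d : ℕ} (ħ : ℝ) (g γ : 𝓢(Rd d, ℂ)) (f : 𝓢'(Rd d, ℂ)) (z : Rd d × Rd d) : ℂ :=
  gabor ħ g (fresnelDist d ħ) z.1 z.2 * conjGabor ħ γ f z.1 z.2

/-- The pairing `⟨γ, g⟩⁻¹ ∫ V_g F₊(x, ξ) 𝒱_γ f(x, ξ) dx dξ`. -/
def phasePairing {d : ℕ} (ħ : ℝ) (g γ : 𝓢(Rd d, ℂ)) (f : 𝓢'(Rd d, ℂ)) : ℂ :=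
  (schwartzInner γ g)⁻¹ * ∫ z : Rd d × Rd d, phaseIntegrand ħ g γ f z

/-- The distribution `f` is Fresnel integrable with Fresnel integral `I`: whatever the cutoff `φ`
with `φ(0) = 1` and the windows `g`, `γ` with `⟨γ, g⟩ ≠ 0`, the regularized pairings are given by
absolutely convergent integrals and tend to `I` as `ε ↓ 0`. -/
def HasFresnelIntegral {d : ℕ} (ħ : ℝ) (f : 𝓢'(Rd d, ℂ)) (I : ℂ) : Prop :=
  ∀ φ g γ : 𝓢(Rd d, ℂ), φ 0 = 1 → schwartzInner γ g ≠ 0 →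
    (∀ ε : ℝ, 0 < ε → Integrable (phaseIntegrand ħ g γ (regularize φ ε f))) ∧
    Tendsto (fun ε : ℝ => phasePairing ħ g γ (regularize φ ε f)) (𝓝[>] 0) (𝓝 I)

end

end FresnelGabor

/-! The proof rests on two facts about phase space. A translate of the chirp `F₊` is, up to a
unimodular factor, a modulation of it, so `|V_g F₊(x, ξ)|` is a function of `ξ - x` alone, namely
the modulus of the Fourier transform of the Schwartz function `F₊ conj(g)`, and decays rapidly away
from the diagonal (`norm_gabor_fresnelDist`). On the other side, the Fourier transform turns phase
space by a quarter turn, so for `f` in `W^{∞,1}` the envelope `H(x) = sup_ξ |f(π(x, ξ)γ)|` is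
integrable for every `γ` (`MemWienerAmalgam.lintegral_supEnvelope_lt_top`). The integrand is
therefore bounded by `K w(ξ - x) H(x)` with `w` integrable, which gives absolute convergence.

Multiplication of `f` by `φ_ε` averages `f(π(x, ξ)γ)` over the frequencies `ξ + εη` against a fixed
density of total mass `φ(0) = 1` (`regularize_phaseShift`). The envelope thus grows at most by a
factor independent of `ε`, and dominated convergence gives the limit.

Independence of the windows follows by expanding `f` with the Gabor inversion formula for a second
pair, exchanging the integrals, and contracting with the inversion formula for `F₊`
(`schwartzInner_mul_integral_phaseIntegrand`). Inversion for distributions needs a tempered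
distribution to pass through a Schwartz-valued integral; this is `integrable_and_integral_tempered`.
-/

namespace FresnelGabor

noncomputable section

/-! ### Tempered distributions and integrals of Schwartz-valued functions -/

/-- A linear map controlled by finitely many Banach-space-valued linear maps commutes with
integrals as soon as these maps do. -/
theorem integrable_and_integral_of_norm_le_pi {S Z ι : Type*} [AddCommGroup S] [Module ℝ S]
    [Fintype ι] {E : ι → Type*} [∀ i, NormedAddCommGroup (E i)] [∀ i, NormedSpace ℝ (E i)]
    [∀ i, CompleteSpace (E i)] [MeasurableSpace Z] {μ : Measure Z}
    (Φ : (i : ι) → S →ₗ[ℝ] E i) (T : S →ₗ[ℝ] ℂ) (C : ℝ)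
    (hT : ∀ φ, ‖T φ‖ ≤ C * ‖(fun i => Φ i φ : (i : ι) → E i)‖) {F : Z → S} {G : S}
    (hF : ∀ i, Integrable (fun z => Φ i (F z)) μ)
    (hG : ∀ i, Φ i G = ∫ z, Φ i (F z) ∂μ) :
    Integrable (fun z => T (F z)) μ ∧ ∫ z, T (F z) ∂μ = T G := by
  let Ψ : S →ₗ[ℝ] ((i : ι) → E i) := LinearMap.pi Φ
  -- The norm bound makes `T` factor through the range of `Ψ` as a bounded functional.
  have hker : LinearMap.ker Ψ ≤ LinearMap.ker T := by
    intro φ hφ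
    have h0 : (fun i => Φ i φ : (i : ι) → E i) = 0 := LinearMap.mem_ker.1 hφ
    have := hT φ
    rw [h0, norm_zero, mul_zero] at this
    exact norm_le_zero_iff.1 this
  let e := Ψ.quotKerEquivRange
  let f₀ : LinearMap.range Ψ →ₗ[ℝ] ℂ := ((LinearMap.ker Ψ).liftQ T hker).comp e.symm.toLinearMap
  have hf₀ : ∀ φ, f₀ ⟨Ψ φ, φ, rfl⟩ = T φ := by
    intro φ
    have : e.symm ⟨Ψ φ, φ, rfl⟩ = Submodule.Quotient.mk φ := by
      rw [LinearEquiv.symm_apply_eq]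
      ext1
      rfl
    simp [f₀, this]
  let f : LinearMap.range Ψ →L[ℝ] ℂ := f₀.mkContinuous C (by
    rintro ⟨_, φ, rfl⟩
    rw [hf₀]
    exact hT φ)
  -- Hahn–Banach: the range of `Ψ` need not be closed, but the extension `L` lives on a Banach
  -- space, where it commutes with Bochner integrals.
  obtain ⟨L, hL⟩ := f.exist_extension_of_finiteDimensional_range
  have hLT : ∀ φ, L (Ψ φ) = T φ := by
    intro φ
    have := DFunLike.congr_fun hL ⟨Ψ φ, φ, rfl⟩
    rw [← hf₀]
    exact this.symm
  have hint : Integrable (fun z => Ψ (F z)) μ := Integrable.of_eval hF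
  have h2 : ∫ z, Ψ (F z) ∂μ = Ψ G := by
    ext i
    exact (eval_integral hF i).trans (hG i).symm
  constructor
  · simpa only [hLT] using L.integrable_comp hint
  · have := L.integral_comp_comm hint
    simpa only [hLT, h2] using this

variable {d : ℕ}

/-- Bounded continuous functions with values in a normed group. -/
abbrev NormedBCF (X V : Type*) [TopologicalSpace X] [NormedAddCommGroup V] : Type _ :=
  BoundedContinuousFunction X V

/-- The function `x ↦ ‖x‖ ^ k • D^n φ(x)` as a bounded continuous function. -/
def weightedDeriv (k n : ℕ) : 𝓢(Rd d, ℂ) →ₗ[ℝ]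
    NormedBCF (Rd d) (ContinuousMultilinearMap ℝ (fun _ : Fin n => Rd d) ℂ) where
  toFun φ := BoundedContinuousFunction.ofNormedAddCommGroup
    (fun x => ‖x‖ ^ k • iteratedFDeriv ℝ n φ x)
    ((continuous_norm.pow k).smul
      ((φ.smooth ⊤).continuous_iteratedFDeriv (by exact_mod_cast le_top)))
    (SchwartzMap.seminorm ℝ k n φ) (fun x => by
      rw [norm_smul, norm_pow, norm_norm]
      exact φ.le_seminorm ℝ k n x)
  map_add' φ ψ := by
    ext1 x
    have : iteratedFDeriv ℝ n (φ + ψ : 𝓢(Rd d, ℂ)) x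
        = iteratedFDeriv ℝ n φ x + iteratedFDeriv ℝ n ψ x :=
      iteratedFDeriv_add_apply (φ.contDiffAt n) (ψ.contDiffAt n)
    change ‖x‖ ^ k • iteratedFDeriv ℝ n (φ + ψ : 𝓢(Rd d, ℂ)) x = ‖x‖ ^ k • iteratedFDeriv ℝ n φ x
      + ‖x‖ ^ k • iteratedFDeriv ℝ n ψ x
    rw [this, smul_add]
  map_smul' c φ := by
    ext1 x
    have : iteratedFDeriv ℝ n (c • φ : 𝓢(Rd d, ℂ)) x = c • iteratedFDeriv ℝ n φ x :=
      iteratedFDeriv_const_smul_apply (φ.contDiffAt n)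
    change ‖x‖ ^ k • iteratedFDeriv ℝ n (c • φ : 𝓢(Rd d, ℂ)) x
      = c • (‖x‖ ^ k • iteratedFDeriv ℝ n φ x)
    rw [this, smul_comm]

theorem weightedDeriv_apply (k n : ℕ) (φ : 𝓢(Rd d, ℂ)) (x : Rd d) :
    weightedDeriv k n φ x = ‖x‖ ^ k • iteratedFDeriv ℝ n φ x := rfl

theorem norm_weightedDeriv_le (k n : ℕ) (φ : 𝓢(Rd d, ℂ)) :
    ‖weightedDeriv k n φ‖ ≤ SchwartzMap.seminorm ℝ k n φ := by
  refine (BoundedContinuousFunction.norm_le (apply_nonneg _ _)).2 fun x => ?_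
  rw [weightedDeriv_apply, norm_smul, norm_pow, norm_norm]
  exact φ.le_seminorm ℝ k n x

theorem seminorm_le_norm_weightedDeriv (k n : ℕ) (φ : 𝓢(Rd d, ℂ)) :
    SchwartzMap.seminorm ℝ k n φ ≤ ‖weightedDeriv k n φ‖ := by
  have h0 : 0 ≤ ‖weightedDeriv k n φ‖ := norm_nonneg _
  refine φ.seminorm_le_bound ℝ k n h0 fun x => ?_
  have := (weightedDeriv k n φ).norm_coe_le_norm x
  rwa [weightedDeriv_apply, norm_smul, norm_pow, norm_norm] at this

theorem continuous_weightedDeriv (k n : ℕ) :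
    Continuous (weightedDeriv k n : 𝓢(Rd d, ℂ) → _) := by
  have h := (schwartz_withSeminorms ℝ (Rd d) ℂ).continuous_seminorm (k, n)
  refine continuous_of_continuousAt_zero (weightedDeriv k n) ?_
  rw [ContinuousAt, map_zero, tendsto_zero_iff_norm_tendsto_zero]
  have h1 := h.tendsto 0
  rw [map_zero] at h1
  exact squeeze_zero (fun _ => norm_nonneg _) (fun φ => norm_weightedDeriv_le k n φ) h1

theorem continuous_iteratedFDeriv_comp {Z : Type*} [TopologicalSpace Z]
    {F : Z → 𝓢(Rd d, ℂ)} (hF : Continuous F) (n : ℕ) (y : Rd d) : Continuous fun z => iteratedFDeriv ℝ n (F z) y := by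
  have h := ((continuous_weightedDeriv (d := d) 0 n).comp hF)
  have h2 := (continuous_eval_const y).comp h
  simpa [Function.comp_def, weightedDeriv_apply] using h2

section Pettis

variable {Z : Type*} [TopologicalSpace Z] [SecondCountableTopology Z] [MeasurableSpace Z]
  [OpensMeasurableSpace Z] {μ : Measure Z}

theorem integrable_iteratedFDeriv {F : Z → 𝓢(Rd d, ℂ)} (hF : Continuous F) {n : ℕ}
    (hint : Integrable (fun z => SchwartzMap.seminorm ℝ 0 n (F z)) μ) (y : Rd d) :
    Integrable (fun z => iteratedFDeriv ℝ n (F z) y) μ :=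
  hint.mono' (continuous_iteratedFDeriv_comp hF n y).aestronglyMeasurable
    (Eventually.of_forall fun z => (F z).norm_iteratedFDeriv_le_seminorm ℝ n y)

/-- Differentiation under the integral sign, one order at a time; the seminorm of order `n + 1`
bounds the next derivative uniformly in `y`, so it serves as the dominating function. -/
theorem iteratedFDeriv_integral {F : Z → 𝓢(Rd d, ℂ)} (hF : Continuous F)
    (hint : ∀ k n, Integrable (fun z => SchwartzMap.seminorm ℝ k n (F z)) μ)
    {G : 𝓢(Rd d, ℂ)} (hG : ∀ y, G y = ∫ z, F z y ∂μ) (n : ℕ) (y : Rd d) :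
    iteratedFDeriv ℝ n G y = ∫ z, iteratedFDeriv ℝ n (F z) y ∂μ := by
  have hcont := fun n y => (continuous_iteratedFDeriv_comp hF n y).aestronglyMeasurable (μ := μ)
  have hI := fun n y => integrable_iteratedFDeriv hF (hint 0 n) y
  induction n generalizing y with
  | zero =>
    ext m
    rw [ContinuousMultilinearMap.integral_apply (hI 0 y)]
    simp [hG]
  | succ n ih =>
    let e := continuousMultilinearCurryLeftEquiv ℝ (fun _ : Fin (n + 1) => Rd d) ℂ
    have hfd : ∀ y z, fderiv ℝ (iteratedFDeriv ℝ n (F z)) y =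
        e (iteratedFDeriv ℝ (n + 1) (F z) y) := by
      intro y z
      rw [iteratedFDeriv_succ_eq_comp_left]
      exact (e.apply_symm_apply _).symm
    have key : HasFDerivAt (fun y => ∫ z, iteratedFDeriv ℝ n (F z) y ∂μ)
        (∫ z, fderiv ℝ (iteratedFDeriv ℝ n (F z)) y ∂μ) y := by
      refine hasFDerivAt_integral_of_dominated_of_fderiv_le
        (F' := fun y z => fderiv ℝ (iteratedFDeriv ℝ n (F z)) y)
        (bound := fun z => SchwartzMap.seminorm ℝ 0 (n + 1) (F z)) univ_mem
        (Eventually.of_forall fun y => hcont n y) (hI n y) ?_ ?_ (hint 0 (n + 1)) ?_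
      · simp only [hfd]
        exact e.continuous.comp_aestronglyMeasurable (hcont (n + 1) y)
      · refine Eventually.of_forall fun z y _ => ?_
        rw [hfd, LinearIsometryEquiv.norm_map]
        exact (F z).norm_iteratedFDeriv_le_seminorm ℝ (n + 1) y
      · refine Eventually.of_forall fun z y _ => DifferentiableAt.hasFDerivAt ?_
        exact ((F z).smooth ⊤).differentiable_iteratedFDeriv
          (by exact_mod_cast ENat.natCast_lt_top n) y
    have hfun : iteratedFDeriv ℝ n G = fun y => ∫ z, iteratedFDeriv ℝ n (F z) y ∂μ := funext ih
    rw [iteratedFDeriv_succ_eq_comp_left, Function.comp_apply, hfun, key.fderiv]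
    simp only [hfd]
    change e.symm _ = _
    rw [LinearIsometryEquiv.symm_apply_eq]
    exact LinearIsometry.integral_comp_comm (𝕜 := ℝ) (E := Rd d [×(n + 1)]→L[ℝ] ℂ)
      (F := Rd d →L[ℝ] Rd d [×n]→L[ℝ] ℂ) (μ := μ) e.toLinearIsometry _

/-- Tempered distributions commute with integrals of continuous Schwartz-valued functions all of
whose seminorms are integrable. -/
theorem integrable_and_integral_tempered {F : Z → 𝓢(Rd d, ℂ)} (hF : Continuous F)
    (hint : ∀ k n, Integrable (fun z => SchwartzMap.seminorm ℝ k n (F z)) μ)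
    {G : 𝓢(Rd d, ℂ)} (hG : ∀ y, G y = ∫ z, F z y ∂μ) (T : 𝓢'(Rd d, ℂ)) :
    Integrable (fun z => T (F z)) μ ∧ ∫ z, T (F z) ∂μ = T G := by
  -- Continuity of `T` gives a bound by finitely many Schwartz seminorms; their index set `s`
  -- indexes the Banach product.
  obtain ⟨s, C, -, hTb⟩ := Seminorm.bound_of_continuous (schwartz_withSeminorms ℝ (Rd d) ℂ)
    ((normSeminorm ℝ ℂ).comp (T.toLinearMap.restrictScalars ℝ))
    (continuous_norm.comp T.continuous)
  -- Bounded continuous functions need not form a separable space; strong measurability comes from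
  -- continuity and the second countability of `Z`.
  have hI : ∀ k n, Integrable (fun z => weightedDeriv k n (F z)) μ := fun k n =>
    (hint k n).mono' ((continuous_weightedDeriv k n).comp hF).aestronglyMeasurable
      (Eventually.of_forall fun z => norm_weightedDeriv_le k n (F z))
  refine integrable_and_integral_of_norm_le_pi (ι := s)
    (fun i => weightedDeriv (d := d) i.1.1 i.1.2) (T.toLinearMap.restrictScalars ℝ) C ?_
    (fun i => hI _ _) ?_
  · intro φ
    refine (hTb φ).trans ?_
    simp only [smul_apply, NNReal.smul_def, smul_eq_mul]
    refine mul_le_mul_of_nonneg_left ?_ C.2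
    refine Seminorm.finset_sup_apply_le (norm_nonneg _) fun i hi => ?_
    refine (seminorm_le_norm_weightedDeriv i.1 i.2 φ).trans ?_
    exact norm_le_pi_norm (fun j : s => weightedDeriv j.1.1 j.1.2 φ) ⟨i, hi⟩
  · rintro ⟨⟨k, n⟩, -⟩
    ext1 x
    have := (BoundedContinuousFunction.evalCLM ℝ x).integral_comp_comm (hI k n)
    refine Eq.trans ?_ this
    simp only [BoundedContinuousFunction.evalCLM_apply, weightedDeriv_apply]
    rw [integral_smul, iteratedFDeriv_integral hF hint hG]

end Pettis

/-! ### Polynomially bounded families of operators -/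

/-- A family of operators on the Schwartz space, indexed by `ℝ^d`, whose norms with respect to
continuous seminorms grow at most polynomially in the parameter. -/
def PolynomiallyBounded (A : Rd d → 𝓢(Rd d, ℂ) →L[ℂ] 𝓢(Rd d, ℂ)) : Prop :=
  ∀ p : Seminorm ℂ 𝓢(Rd d, ℂ), Continuous p → ∃ (a : ℕ) (q : Seminorm ℂ 𝓢(Rd d, ℂ)),
    Continuous q ∧ ∀ x u, p (A x u) ≤ (1 + ‖x‖) ^ a * q u

/-- Strong joint continuity of polynomially bounded families. -/
theorem PolynomiallyBounded.continuous_apply {A : Rd d → 𝓢(Rd d, ℂ) →L[ℂ] 𝓢(Rd d, ℂ)}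
    (hA : PolynomiallyBounded A) (hc : ∀ u, Continuous fun x => A x u) {Z : Type*}
    [TopologicalSpace Z] {ξ : Z → Rd d} (hξ : Continuous ξ) {v : Z → 𝓢(Rd d, ℂ)}
    (hv : Continuous v) : Continuous fun z => A (ξ z) (v z) := by
  rw [continuous_iff_continuousAt]
  intro z₀
  rw [ContinuousAt, (schwartz_withSeminorms ℂ (Rd d) ℂ).tendsto_nhds]
  intro i ε hε
  have hpc := (schwartz_withSeminorms ℂ (Rd d) ℂ).continuous_seminorm i
  generalize schwartzSeminormFamily ℂ (Rd d) ℂ i = p at hpc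
  obtain ⟨a, q, hq, hpq⟩ := hA p hpc
  have h1 : Continuous fun z => (1 + ‖ξ z‖) ^ a * q (v z - v z₀) + p (A (ξ z) (v z₀) -
      A (ξ z₀) (v z₀)) := by
    have := (hc (v z₀)).comp hξ
    refine Continuous.add ?_ ?_
    · exact ((continuous_const.add hξ.norm).pow a).mul (hq.comp (hv.sub continuous_const))
    · exact hpc.comp (this.sub continuous_const)
  have h2 := h1.tendsto z₀
  simp only [sub_self, map_zero, mul_zero, add_zero] at h2
  filter_upwards [h2.eventually_lt_const hε] with z hz
  refine lt_of_le_of_lt ?_ hz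
  -- The first term is small because the bound on `A (ξ z)` is locally uniform in `z`, the second by
  -- strong continuity at the fixed vector `v z₀`.
  have h3 : A (ξ z) (v z) - A (ξ z₀) (v z₀) = A (ξ z) (v z - v z₀) +
      (A (ξ z) (v z₀) - A (ξ z₀) (v z₀)) := by
    rw [map_sub]
    abel
  rw [h3]
  exact (map_add_le_add p _ _).trans (add_le_add_left (hpq _ _) _)

theorem one_add_norm_le_mul (x y : Rd d) : 1 + ‖y‖ ≤ (1 + ‖x‖) * (1 + ‖y - x‖) := by
  have := norm_le_norm_add_norm_sub' y x
  nlinarith [norm_nonneg x, norm_nonneg (y - x), mul_nonneg (norm_nonneg x) (norm_nonneg (y - x))]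

/-! ### Translations -/

/-- The translation `u ↦ u(· - x)` of Schwartz functions. -/
def translate (x : Rd d) : 𝓢(Rd d, ℂ) →L[ℂ] 𝓢(Rd d, ℂ) := SchwartzMap.compSubConstCLM ℂ x

@[simp]
theorem translate_apply (x : Rd d) (u : 𝓢(Rd d, ℂ)) (y : Rd d) : translate x u y = u (y - x) := rfl

theorem iteratedFDeriv_translate (n : ℕ) (x : Rd d) (u : 𝓢(Rd d, ℂ)) (y : Rd d) :
    iteratedFDeriv ℝ n (translate x u) y = iteratedFDeriv ℝ n u (y - x) :=
  iteratedFDeriv_comp_sub n x y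

theorem seminorm_translate_le (k n : ℕ) (x : Rd d) (u : 𝓢(Rd d, ℂ)) :
    SchwartzMap.seminorm ℂ k n (translate x u) ≤ (1 + ‖x‖) ^ k *
      (2 ^ k * (Finset.Iic (k, n)).sup (schwartzSeminormFamily ℂ (Rd d) ℂ) u) := by
  refine SchwartzMap.seminorm_le_bound ℂ k n _ (by positivity) fun y => ?_
  rw [iteratedFDeriv_translate]
  have h1 := u.one_add_le_sup_seminorm_apply (𝕜 := ℂ) (m := (k, n)) le_rfl le_rfl (y - x)
  calc ‖y‖ ^ k * ‖iteratedFDeriv ℝ n u (y - x)‖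
      ≤ ((1 + ‖x‖) * (1 + ‖y - x‖)) ^ k * ‖iteratedFDeriv ℝ n u (y - x)‖ := by
        gcongr
        linarith [one_add_norm_le_mul x y]
    _ = (1 + ‖x‖) ^ k * ((1 + ‖y - x‖) ^ k * ‖iteratedFDeriv ℝ n u (y - x)‖) := by
        rw [mul_pow, mul_assoc]
    _ ≤ _ := mul_le_mul_of_nonneg_left h1 (by positivity)

theorem polynomiallyBounded_translate : PolynomiallyBounded (translate (d := d)) := by
  intro p hp
  obtain ⟨s, C, -, hs⟩ := Seminorm.bound_of_continuous (schwartz_withSeminorms ℂ (Rd d) ℂ) p hp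
  have hcs := (schwartz_withSeminorms ℂ (Rd d) ℂ).continuous_seminorm
  let q : ℕ × ℕ → Seminorm ℂ 𝓢(Rd d, ℂ) := fun i =>
    (2 ^ i.1 : NNReal) • (Finset.Iic i).sup (schwartzSeminormFamily ℂ (Rd d) ℂ)
  have hq : ∀ i, Continuous (q i) := fun i =>
    (Seminorm.continuous_finsetSup fun j _ => hcs j).const_smul _
  refine ⟨s.sup Prod.fst, C • s.sup q, (Seminorm.continuous_finsetSup fun j _ => hq j).const_smul _,
    fun x u => ?_⟩
  refine (hs _).trans ?_
  simp only [smul_apply, NNReal.smul_def, smul_eq_mul]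
  rw [mul_left_comm]
  refine mul_le_mul_of_nonneg_left ?_ C.2
  refine Seminorm.finset_sup_apply_le (by positivity) fun i hi => ?_
  refine (seminorm_translate_le i.1 i.2 x u).trans ?_
  refine mul_le_mul ?_ ?_ (by positivity) (by positivity)
  · exact pow_le_pow_right₀ (by linarith [norm_nonneg x]) (Finset.le_sup (f := Prod.fst) hi)
  · exact Seminorm.le_def.1 (Finset.le_sup (f := q) hi) u

/-- Mean value inequality in the shift parameter: differentiating `D^n u(y - w)` in `w` costs one
derivative of `u`, and the resulting Lipschitz constant does not depend on `y`. -/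
theorem seminorm_translate_sub_le (k n : ℕ) (x x₀ : Rd d) (u : 𝓢(Rd d, ℂ)) {B : ℝ}
    (hB : ∀ w ∈ Metric.ball x₀ 1, SchwartzMap.seminorm ℂ k (n + 1) (translate w u) ≤ B)
    (hx : x ∈ Metric.ball x₀ 1) :
    SchwartzMap.seminorm ℂ k n (translate x u - translate x₀ u) ≤ B * ‖x - x₀‖ := by
  have hx₀ : x₀ ∈ Metric.ball x₀ 1 := Metric.mem_ball_self one_pos
  have hB0 : 0 ≤ B := (apply_nonneg _ _).trans (hB x₀ hx₀)
  refine SchwartzMap.seminorm_le_bound ℂ k n _ (by positivity) fun y => ?_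
  have h1 : iteratedFDeriv ℝ n (translate x u - translate x₀ u : 𝓢(Rd d, ℂ)) y
      = iteratedFDeriv ℝ n u (y - x) - iteratedFDeriv ℝ n u (y - x₀) := by
    rw [← iteratedFDeriv_translate, ← iteratedFDeriv_translate]
    exact iteratedFDeriv_sub_apply ((translate x u).contDiffAt n) ((translate x₀ u).contDiffAt n)
  have hdiff : Differentiable ℝ (iteratedFDeriv ℝ n u) :=
    (u.smooth ⊤).differentiable_iteratedFDeriv (by exact_mod_cast ENat.natCast_lt_top n)
  let f := fun w => ‖y‖ ^ k • iteratedFDeriv ℝ n u (y - w)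
  have hd : ∀ w, HasFDerivAt f
      (‖y‖ ^ k • ((fderiv ℝ (iteratedFDeriv ℝ n u) (y - w)).comp
        (-(ContinuousLinearMap.id ℝ (Rd d))))) w := fun w =>
    ((hdiff (y - w)).hasFDerivAt.comp w ((hasFDerivAt_id w).const_sub y)).const_smul (‖y‖ ^ k)
  have h2 : ‖f x - f x₀‖ ≤ B * ‖x - x₀‖ := by
    refine Convex.norm_image_sub_le_of_norm_fderiv_le (𝕜 := ℝ)
      (fun w _ => (hd w).differentiableAt) (fun w hw => ?_) (convex_ball x₀ 1) hx₀ hx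
    rw [(hd w).fderiv, norm_smul, norm_pow, norm_norm, ContinuousLinearMap.comp_neg, norm_neg,
      ContinuousLinearMap.comp_id, norm_fderiv_iteratedFDeriv, ← iteratedFDeriv_translate]
    exact ((translate w u).le_seminorm ℂ k (n + 1) y).trans (hB w hw)
  rw [h1]
  simpa only [f, ← smul_sub, norm_smul, norm_pow, norm_norm] using h2

theorem continuous_translate (u : 𝓢(Rd d, ℂ)) : Continuous fun x => translate x u := by
  rw [continuous_iff_continuousAt]
  intro x₀
  rw [ContinuousAt, (schwartz_withSeminorms ℂ (Rd d) ℂ).tendsto_nhds]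
  rintro ⟨k, n⟩ ε hε
  obtain ⟨a, q, -, hq⟩ := polynomiallyBounded_translate (d := d) (SchwartzMap.seminorm ℂ k (n + 1))
    ((schwartz_withSeminorms ℂ (Rd d) ℂ).continuous_seminorm (k, n + 1))
  let B := (1 + (‖x₀‖ + 1)) ^ a * q u
  have hB : ∀ w ∈ Metric.ball x₀ 1, SchwartzMap.seminorm ℂ k (n + 1) (translate w u) ≤ B := by
    intro w hw
    refine (hq w u).trans ?_
    have : ‖w‖ ≤ ‖x₀‖ + 1 := by
      have := norm_le_norm_add_norm_sub' w x₀
      have h2 := mem_ball_iff_norm.1 hw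
      linarith
    simp only [B]
    gcongr
  have h1 : Tendsto (fun x => B * ‖x - x₀‖) (𝓝 x₀) (𝓝 0) := by
    have : Continuous fun x => B * ‖x - x₀‖ := by fun_prop
    simpa using this.tendsto x₀
  filter_upwards [h1.eventually_lt_const hε, Metric.ball_mem_nhds x₀ one_pos] with x hx hx1
  exact (seminorm_translate_sub_le k n x x₀ u hB hx1).trans_lt hx

/-! ### Modulations -/

/-- Multiplication of Schwartz functions by the character of frequency `ξ`. -/
def modulate (ħ : ℝ) (ξ : Rd d) : 𝓢(Rd d, ℂ) →L[ℂ] 𝓢(Rd d, ℂ) :=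
  SchwartzMap.smulLeftCLM ℂ (character ħ ξ)

@[simp]
theorem modulate_apply (ħ : ℝ) (ξ : Rd d) (u : 𝓢(Rd d, ℂ)) (y : Rd d) :
    modulate ħ ξ u y = character ħ ξ y * u y := by
  simp [modulate, SchwartzMap.smulLeftCLM_apply_apply (hasTemperateGrowth_character ħ ξ)]

theorem fourier_modulate {ħ : ℝ} (hħ : 0 < ħ) (ξ : Rd d) (u : 𝓢(Rd d, ℂ)) :
    𝓕 (modulate ħ ξ u) = translate ((2 * Real.pi * ħ)⁻¹ • ξ) (𝓕 u) := by
  ext η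
  rw [translate_apply, SchwartzMap.fourier_coe, SchwartzMap.fourier_coe, Real.fourier_eq',
    Real.fourier_eq']
  refine integral_congr_ae (Eventually.of_forall fun y => ?_)
  simp only [modulate_apply, character, smul_eq_mul]
  rw [← mul_assoc, ← Complex.exp_add]
  congr 2
  have h0 : (ħ : ℂ) ≠ 0 := by exact_mod_cast hħ.ne'
  have hpi : (Real.pi : ℂ) ≠ 0 := by exact_mod_cast Real.pi_ne_zero
  rw [inner_sub_right, real_inner_smul_right, real_inner_comm y ξ]
  push_cast
  field_simp
  ring

/-- Conjugation by the Fourier transform lets modulations inherit the polynomial bounds and strong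
continuity of translations. -/
theorem modulate_eq {ħ : ℝ} (hħ : 0 < ħ) (ξ : Rd d) (u : 𝓢(Rd d, ℂ)) :
    modulate ħ ξ u = FourierTransform.fourierInvCLM ℂ 𝓢(Rd d, ℂ)
      (translate ((2 * Real.pi * ħ)⁻¹ • ξ) (FourierTransform.fourierCLM ℂ 𝓢(Rd d, ℂ) u)) := by
  have := congrArg 𝓕⁻ (fourier_modulate hħ ξ u)
  rw [FourierTransform.fourierInv_fourier_eq] at this
  exact this

theorem polynomiallyBounded_modulate {ħ : ℝ} (hħ : 0 < ħ) :
    PolynomiallyBounded (modulate (d := d) ħ) := by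
  intro p hp
  obtain ⟨a, q, hq, hpq⟩ := polynomiallyBounded_translate
    (p.comp (FourierTransform.fourierInvCLM ℂ 𝓢(Rd d, ℂ)).toLinearMap)
    (hp.comp (FourierTransform.fourierInvCLM ℂ 𝓢(Rd d, ℂ)).continuous)
  have hc : 0 < (2 * Real.pi * ħ)⁻¹ := by positivity
  let C : NNReal := ⟨(1 + (2 * Real.pi * ħ)⁻¹) ^ a, by positivity⟩
  refine ⟨a, C • q.comp (FourierTransform.fourierCLM ℂ 𝓢(Rd d, ℂ)).toLinearMap,
    (hq.comp (FourierTransform.fourierCLM ℂ 𝓢(Rd d, ℂ)).continuous).const_smul _, fun ξ u => ?_⟩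
  rw [modulate_eq hħ]
  refine (hpq _ _).trans ?_
  have hq0 : 0 ≤ q (FourierTransform.fourierCLM ℂ 𝓢(Rd d, ℂ) u) := apply_nonneg _ _
  have h1 : (1 + ‖(2 * Real.pi * ħ)⁻¹ • ξ‖) ^ a ≤ (1 + ‖ξ‖) ^ a * (1 + (2 * Real.pi * ħ)⁻¹) ^ a := by
    rw [← mul_pow, norm_smul, Real.norm_of_nonneg hc.le]
    gcongr
    nlinarith [norm_nonneg ξ]
  calc _ ≤ ((1 + ‖ξ‖) ^ a * (1 + (2 * Real.pi * ħ)⁻¹) ^ a) *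
        q (FourierTransform.fourierCLM ℂ 𝓢(Rd d, ℂ) u) := by gcongr
    _ = _ := by rw [mul_assoc]; rfl

theorem continuous_modulate {ħ : ℝ} (hħ : 0 < ħ) (u : 𝓢(Rd d, ℂ)) :
    Continuous fun ξ => modulate ħ ξ u := by
  simp only [modulate_eq hħ]
  exact (ContinuousLinearMap.continuous _).comp
    ((continuous_translate _).comp (continuous_const_smul _))

/-! ### Phase space shifts -/

theorem phaseShift_eq (ħ : ℝ) (x ξ : Rd d) (g : 𝓢(Rd d, ℂ)) :
    phaseShift ħ x ξ g = (normConst d ħ : ℂ) • modulate ħ ξ (translate x g) := rfl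

theorem continuous_phaseShift {ħ : ℝ} (hħ : 0 < ħ) (g : 𝓢(Rd d, ℂ)) :
    Continuous fun z : Rd d × Rd d => phaseShift ħ z.1 z.2 g := by
  simp only [phaseShift_eq]
  exact Continuous.const_smul ((polynomiallyBounded_modulate hħ).continuous_apply
    (continuous_modulate hħ) continuous_snd ((continuous_translate g).comp continuous_fst))
    (normConst d ħ : ℂ)

theorem exists_seminorm_phaseShift_le {ħ : ℝ} (hħ : 0 < ħ) (g : 𝓢(Rd d, ℂ))
    {p : Seminorm ℂ 𝓢(Rd d, ℂ)} (hp : Continuous p) : ∃ (a : ℕ) (C : ℝ), 0 ≤ C ∧ ∀ x ξ,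
      p (phaseShift ħ x ξ g) ≤ C * ((1 + ‖x‖) ^ a * (1 + ‖ξ‖) ^ a) := by
  obtain ⟨a, q, hq, hpq⟩ := polynomiallyBounded_modulate hħ p hp
  obtain ⟨b, r, -, hqr⟩ := polynomiallyBounded_translate q hq
  refine ⟨max a b, ‖(normConst d ħ : ℂ)‖ * r g, by positivity, fun x ξ => ?_⟩
  rw [phaseShift_eq, map_smul_eq_mul, mul_assoc]
  refine mul_le_mul_of_nonneg_left ?_ (norm_nonneg _)
  have h1 : (1 + ‖ξ‖) ^ a ≤ (1 + ‖ξ‖) ^ max a b :=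
    pow_le_pow_right₀ (by linarith [norm_nonneg ξ]) (le_max_left _ _)
  have h2 : (1 + ‖x‖) ^ b ≤ (1 + ‖x‖) ^ max a b :=
    pow_le_pow_right₀ (by linarith [norm_nonneg x]) (le_max_right _ _)
  calc p (modulate ħ ξ (translate x g)) ≤ (1 + ‖ξ‖) ^ a * ((1 + ‖x‖) ^ b * r g) :=
        (hpq _ _).trans (mul_le_mul_of_nonneg_left (hqr _ _) (by positivity))
    _ ≤ (1 + ‖ξ‖) ^ max a b * ((1 + ‖x‖) ^ max a b * r g) := by gcongr
    _ = _ := by ring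

/-! ### Characters -/

theorem character_add_right (ħ : ℝ) (ξ x y : Rd d) :
    character ħ ξ (x + y) = character ħ ξ x * character ħ ξ y := by
  simp only [character, ← Complex.exp_add, inner_add_right, mul_add, Complex.ofReal_add, add_mul]

theorem character_comm (ħ : ℝ) (ξ x : Rd d) : character ħ ξ x = character ħ x ξ := by
  simp only [character, real_inner_comm]

theorem character_add_left (ħ : ℝ) (ξ η x : Rd d) :
    character ħ (ξ + η) x = character ħ ξ x * character ħ η x := by
  simp only [character_comm ħ _ x, character_add_right]

theorem character_smul_right (ħ c : ℝ) (ξ x : Rd d) :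
    character ħ ξ (c • x) = character ħ (c • ξ) x := by
  simp only [character, real_inner_smul_left, real_inner_smul_right]

@[simp]
theorem norm_character (ħ : ℝ) (ξ x : Rd d) : ‖character ħ ξ x‖ = 1 :=
  Complex.norm_exp_ofReal_mul_I _

theorem conj_character (ħ : ℝ) (ξ x : Rd d) :
    (starRingEnd ℂ) (character ħ ξ x) = character ħ (-ξ) x := by
  simp [character, ← Complex.exp_conj]

/-! ### The normalizing constant -/

theorem normConst_pos (d : ℕ) {ħ : ℝ} (hħ : 0 < ħ) : 0 < normConst d ħ := by
  unfold normConst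
  positivity

/-- In Fourier inversion the two normalizing constants cancel the Jacobian `(2πħ)^d` of the
dilation. -/
theorem normConst_mul_self (d : ℕ) {ħ : ℝ} (hħ : 0 < ħ) :
    normConst d ħ * normConst d ħ * (2 * Real.pi * ħ) ^ d = 1 := by
  have h : 0 < 2 * Real.pi * ħ := by positivity
  unfold normConst
  rw [← Real.rpow_natCast, ← Real.rpow_add h, ← Real.rpow_add h]
  ring_nf
  simp

/-! ### The Fourier transform with parameter `ħ` -/

theorem fourierS_apply_character {ħ : ℝ} (hħ : 0 < ħ) (g : 𝓢(Rd d, ℂ)) (ξ : Rd d) :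
    fourierS d hħ g ξ = (normConst d ħ : ℂ) * ∫ x, character ħ (-ξ) x * g x := by
  rw [fourierS_apply]
  congr 2
  ext x
  congr 1
  simp only [character, inner_neg_left]
  congr 1
  push_cast
  ring

theorem fourierS_eq_fourier {ħ : ℝ} (hħ : 0 < ħ) (g : 𝓢(Rd d, ℂ)) (ξ : Rd d) :
    fourierS d hħ g ξ = (normConst d ħ : ℂ) * 𝓕 g ((2 * Real.pi * ħ)⁻¹ • ξ) := rfl

/-- Fourier inversion. -/
theorem integral_character_mul_fourierS {ħ : ℝ} (hħ : 0 < ħ) (u : 𝓢(Rd d, ℂ)) (y : Rd d) :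
    (normConst d ħ : ℂ) * ∫ ξ, character ħ ξ y * fourierS d hħ u ξ = u y := by
  have hR : 0 < 2 * Real.pi * ħ := by positivity
  let h : Rd d → ℂ := fun η => Complex.exp ((2 * Real.pi * inner ℝ η y : ℝ) * Complex.I) • 𝓕 u η
  have h1 : ∀ ξ : Rd d, character ħ ξ y * fourierS d hħ u ξ =
      (normConst d ħ : ℂ) * h ((2 * Real.pi * ħ)⁻¹ • ξ) := by
    intro ξ
    simp only [h, fourierS_eq_fourier hħ, smul_eq_mul]
    rw [mul_left_comm]
    congr 2
    simp only [character, real_inner_smul_left]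
    congr 3
    field_simp
  have h2 : ∫ η, h η = u y := by
    have : (𝓕⁻ (𝓕 u)) y = u y := by rw [FourierTransform.fourierInv_fourier_eq]
    rw [← this, SchwartzMap.fourierInv_coe, Real.fourierInv_eq']
  simp only [h1]
  rw [integral_const_mul, Measure.integral_comp_inv_smul_of_nonneg _ h hR.le, h2,
    finrank_euclideanSpace_fin, Complex.real_smul]
  have h3 := congrArg (fun t : ℝ => (t : ℂ)) (normConst_mul_self d hħ)
  push_cast at h3 ⊢
  linear_combination u y * h3

/-- The quarter turn `(x, ξ) ↦ (ξ, -x)` of phase space. It exchanges position and frequency, and so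
links `W^{∞,1}` to `M^{∞,1}`. -/
theorem fourierS_phaseShift {ħ : ℝ} (hħ : 0 < ħ) (x ξ : Rd d) (g : 𝓢(Rd d, ℂ)) :
    fourierS d hħ (phaseShift ħ x ξ g) =
      character ħ ξ x • phaseShift ħ ξ (-x) (fourierS d hħ g) := by
  ext η
  rw [smul_apply, phaseShift_apply, fourierS_apply_character, fourierS_apply_character,
    ← integral_add_right_eq_self _ x, smul_eq_mul]
  simp only [phaseShift_apply, add_sub_cancel_right]
  have h1 : ∀ y, character ħ (-η) (y + x) * ((normConst d ħ : ℂ) * (character ħ ξ (y + x) * g y)) =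
      (normConst d ħ * character ħ ξ x * character ħ (-x) η : ℂ) *
        (character ħ (-(η - ξ)) y * g y) := by
    intro y
    have e1 : -(η - ξ) = -η + ξ := by abel
    have e2 : character ħ (-x) η = character ħ (-η) x := by
      simp only [character, inner_neg_left, real_inner_comm]
    rw [character_add_right, character_add_right, e1, character_add_left, e2]
    ring
  simp only [h1]
  rw [integral_const_mul]
  ring

/-! ### Gabor transforms of Schwartz functions -/

theorem schwartzInner_phaseShift (ħ : ℝ) (ψ g : 𝓢(Rd d, ℂ)) (x ξ : Rd d) :
    schwartzInner ψ (phaseShift ħ x ξ g) = (normConst d ħ : ℂ) *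
      ∫ y, character ħ (-ξ) y * (ψ y * (starRingEnd ℂ) (g (y - x))) := by
  rw [schwartzInner, ← integral_const_mul]
  congr 1
  ext y
  simp only [phaseShift_apply, map_mul, Complex.conj_ofReal, conj_character]
  ring

/-- The product of Schwartz functions, as an operator. -/
def mulS (ψ : 𝓢(Rd d, ℂ)) : 𝓢(Rd d, ℂ) →L[ℂ] 𝓢(Rd d, ℂ) := SchwartzMap.smulLeftCLM ℂ ψ

@[simp]
theorem mulS_apply (ψ u : 𝓢(Rd d, ℂ)) (y : Rd d) : mulS ψ u y = ψ y * u y := by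
  simp [mulS, SchwartzMap.smulLeftCLM_apply_apply ψ.hasTemperateGrowth]

/-- For fixed position, the Gabor transform is the Fourier transform of `ψ` cut off by the
translated window. -/
theorem schwartzInner_phaseShift_eq_fourierS {ħ : ℝ} (hħ : 0 < ħ) (ψ g : 𝓢(Rd d, ℂ))
    (x ξ : Rd d) : schwartzInner ψ (phaseShift ħ x ξ g) =
      fourierS d hħ (mulS ψ (translate x (conjS g))) ξ := by
  rw [schwartzInner_phaseShift, fourierS_apply_character]
  simp

/-- The inverse of `(1 + ‖x‖) ^ (d + 1)`, an integrable weight on `ℝ^d`. -/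
def weight (x : Rd d) : ℝ := ((1 + ‖x‖) ^ (d + 1))⁻¹

theorem weight_pos (x : Rd d) : 0 < weight x := by
  unfold weight
  positivity

theorem continuous_weight : Continuous (weight (d := d)) := by
  unfold weight
  exact ((continuous_const.add continuous_norm).pow _).inv₀
    fun x => (pow_pos (add_pos_of_pos_of_nonneg one_pos (norm_nonneg x)) _).ne'

theorem integrable_weight : Integrable (weight (d := d)) := by
  have h := integrable_one_add_norm (E := Rd d) (μ := volume) (r := ((d + 1 : ℕ) : ℝ))
    (by simp)
  refine h.congr (Eventually.of_forall fun x => ?_)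
  simp only [weight]
  rw [Real.rpow_neg (by positivity), Real.rpow_natCast]

theorem exists_one_add_norm_pow_mul_le (ψ : 𝓢(Rd d, ℂ)) (M : ℕ) :
    ∃ C : ℝ, 0 ≤ C ∧ ∀ y, (1 + ‖y‖) ^ M * ‖ψ y‖ ≤ C := by
  refine ⟨2 ^ M * (Finset.Iic (M, 0)).sup (fun m => SchwartzMap.seminorm ℂ m.1 m.2) ψ,
    by positivity, fun y => ?_⟩
  simpa using ψ.one_add_le_sup_seminorm_apply (𝕜 := ℂ) (m := (M, 0)) le_rfl le_rfl y

theorem exists_norm_le_weight (ψ : 𝓢(Rd d, ℂ)) :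
    ∃ C : ℝ, 0 ≤ C ∧ ∀ y, ‖ψ y‖ ≤ C * weight y := by
  obtain ⟨C, hC, h⟩ := exists_one_add_norm_pow_mul_le ψ (d + 1)
  refine ⟨C, hC, fun y => ?_⟩
  rw [weight, ← div_eq_mul_inv, le_div_iff₀ (by positivity), mul_comm]
  exact h y

theorem integrable_one_add_norm_pow_mul (ψ : 𝓢(Rd d, ℂ)) (M : ℕ) :
    Integrable fun y => (1 + ‖y‖) ^ M * ‖ψ y‖ := by
  obtain ⟨C, hC, h⟩ := exists_one_add_norm_pow_mul_le ψ (M + (d + 1))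
  refine (integrable_weight.const_mul C).mono' ?_ (Eventually.of_forall fun y => ?_)
  · exact (((continuous_const.add continuous_norm).pow M).mul
      ψ.continuous.norm).aestronglyMeasurable
  · rw [Real.norm_of_nonneg (by positivity), weight, ← div_eq_mul_inv,
      le_div_iff₀ (by positivity)]
    refine le_trans (le_of_eq ?_) (h y)
    ring

/-- Since `1 + |x| ≤ (1 + |y|)(1 + |y - x|)`, the decay of `ψ(y)` and of `g(y - x)` together pay for
any power of `1 + |x|`. -/
theorem exists_schwartzInner_phaseShift_le_position {ħ : ℝ} (hħ : 0 < ħ) (ψ g : 𝓢(Rd d, ℂ))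
    (M : ℕ) : ∃ C : ℝ, 0 ≤ C ∧ ∀ x ξ,
      ‖schwartzInner ψ (phaseShift ħ x ξ g)‖ * (1 + ‖x‖) ^ M ≤ C := by
  obtain ⟨C, hC, hg⟩ := exists_one_add_norm_pow_mul_le g M
  have hnc := normConst_pos d hħ
  refine ⟨normConst d ħ * ∫ y, C * ((1 + ‖y‖) ^ M * ‖ψ y‖), by positivity, fun x ξ => ?_⟩
  rw [schwartzInner_phaseShift, norm_mul, Complex.norm_of_nonneg hnc.le, mul_assoc]
  refine mul_le_mul_of_nonneg_left ?_ hnc.le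
  have h1 : ‖∫ y, character ħ (-ξ) y * (ψ y * (starRingEnd ℂ) (g (y - x)))‖ ≤
      ∫ y, (C * ((1 + ‖y‖) ^ M * ‖ψ y‖)) * ((1 + ‖x‖) ^ M)⁻¹ := by
    refine norm_integral_le_of_norm_le
      (((integrable_one_add_norm_pow_mul ψ M).const_mul C).mul_const _)
      (Eventually.of_forall fun y => ?_)
    rw [norm_mul, norm_mul, norm_character, one_mul, RCLike.norm_conj, ← div_eq_mul_inv,
      le_div_iff₀ (by positivity)]
    have h2 : (1 + ‖x‖) ^ M ≤ (1 + ‖y‖) ^ M * (1 + ‖y - x‖) ^ M := by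
      rw [← mul_pow, norm_sub_rev]
      exact pow_le_pow_left₀ (by positivity) (one_add_norm_le_mul y x) M
    calc ‖ψ y‖ * ‖g (y - x)‖ * (1 + ‖x‖) ^ M
        ≤ ‖ψ y‖ * ‖g (y - x)‖ * ((1 + ‖y‖) ^ M * (1 + ‖y - x‖) ^ M) := by gcongr
      _ = ((1 + ‖y - x‖) ^ M * ‖g (y - x)‖) * ((1 + ‖y‖) ^ M * ‖ψ y‖) := by ring
      _ ≤ _ := by
        gcongr
        exact hg (y - x)
  rw [integral_mul_const, ← div_eq_mul_inv, le_div_iff₀ (by positivity)] at h1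
  exact h1

/-- The Fourier transform of a Schwartz function decays rapidly; translating the window by `x` costs
only a power of `1 + |x|`. -/
theorem exists_schwartzInner_phaseShift_le_frequency {ħ : ℝ} (hħ : 0 < ħ) (ψ g : 𝓢(Rd d, ℂ))
    (k : ℕ) : ∃ (a : ℕ) (C : ℝ), 0 ≤ C ∧ ∀ x ξ,
      ‖schwartzInner ψ (phaseShift ħ x ξ g)‖ * (1 + ‖ξ‖) ^ k ≤ C * (1 + ‖x‖) ^ a := by
  let L : 𝓢(Rd d, ℂ) →L[ℂ] 𝓢(Rd d, ℂ) := fourierS d hħ ∘L mulS ψ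
  let p : Seminorm ℂ 𝓢(Rd d, ℂ) := ((Finset.Iic (k, 0)).sup (schwartzSeminormFamily ℂ (Rd d) ℂ))
  have hp : Continuous p := Seminorm.continuous_finsetSup fun j _ =>
    (schwartz_withSeminorms ℂ (Rd d) ℂ).continuous_seminorm j
  obtain ⟨a, q, -, hpq⟩ := polynomiallyBounded_translate (p.comp L.toLinearMap)
    (hp.comp L.continuous)
  refine ⟨a, 2 ^ k * q (conjS g), by positivity, fun x ξ => ?_⟩
  rw [schwartzInner_phaseShift_eq_fourierS hħ, mul_comm]
  have h1 := (L (translate x (conjS g))).one_add_le_sup_seminorm_apply (𝕜 := ℂ) (m := (k, 0))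
    le_rfl le_rfl ξ
  rw [norm_iteratedFDeriv_zero] at h1
  refine h1.trans ?_
  rw [mul_assoc]
  refine mul_le_mul_of_nonneg_left ((hpq x (conjS g)).trans (le_of_eq ?_)) (by positivity)
  ring

/-- Gabor transforms of Schwartz functions decay rapidly. -/
theorem exists_schwartzInner_phaseShift_le {ħ : ℝ} (hħ : 0 < ħ) (ψ g : 𝓢(Rd d, ℂ))
    (N : ℕ) : ∃ C : ℝ, 0 ≤ C ∧ ∀ x ξ,
      ‖schwartzInner ψ (phaseShift ħ x ξ g)‖ * ((1 + ‖x‖) ^ N * (1 + ‖ξ‖) ^ N) ≤ C := by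
  obtain ⟨a, C₁, hC₁, h₁⟩ := exists_schwartzInner_phaseShift_le_frequency hħ ψ g (2 * N)
  obtain ⟨C₂, hC₂, h₂⟩ := exists_schwartzInner_phaseShift_le_position hħ ψ g (a + 2 * N)
  -- Geometric mean of the two bounds: the exponent `a + 2 * N` in position includes `a` to absorb
  -- the growth in `x` of the frequency bound.
  refine ⟨√(C₁ * C₂), Real.sqrt_nonneg _, fun x ξ => Real.le_sqrt_of_sq_le ?_⟩
  have h1 := h₁ x ξ
  have h2 := h₂ x ξ
  have hv : 0 ≤ ‖schwartzInner ψ (phaseShift ħ x ξ g)‖ := norm_nonneg _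
  generalize ‖schwartzInner ψ (phaseShift ħ x ξ g)‖ = v at h1 h2 hv
  have hx : 0 < (1 + ‖x‖) ^ a := by positivity
  refine le_of_mul_le_mul_right ?_ hx
  calc (v * ((1 + ‖x‖) ^ N * (1 + ‖ξ‖) ^ N)) ^ 2 * (1 + ‖x‖) ^ a
      = (v * (1 + ‖ξ‖) ^ (2 * N)) * (v * (1 + ‖x‖) ^ (a + 2 * N)) := by ring
    _ ≤ (C₁ * (1 + ‖x‖) ^ a) * C₂ := by gcongr
    _ = _ := by ring

/-- Phase shifts compose up to a unimodular factor, so the modulus of the Gabor matrix depends only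
on `z - w`. -/
theorem schwartzInner_phaseShift_phaseShift (ħ : ℝ) (g γ : 𝓢(Rd d, ℂ)) (w z : Rd d × Rd d) :
    schwartzInner (phaseShift ħ w.1 w.2 g) (phaseShift ħ z.1 z.2 γ) =
      (normConst d ħ * character ħ (w.2 - z.2) w.1 : ℂ) *
        schwartzInner g (phaseShift ħ (z.1 - w.1) (z.2 - w.2) γ) := by
  rw [schwartzInner_phaseShift, schwartzInner_phaseShift, ← integral_add_right_eq_self _ w.1,
    mul_assoc]
  congr 1
  rw [← mul_assoc, ← integral_const_mul]
  refine integral_congr_ae (Eventually.of_forall fun y => ?_)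
  have e1 : -(z.2 - w.2) = -z.2 + w.2 := by abel
  have e2 : w.2 - z.2 = -z.2 + w.2 := by abel
  have e3 : y + w.1 - z.1 = y - (z.1 - w.1) := by abel
  simp only [phaseShift_apply, add_sub_cancel_right, character_add_right, e1, e2, e3,
    character_add_left]
  ring

theorem norm_schwartzInner_phaseShift_phaseShift {ħ : ℝ} (hħ : 0 < ħ) (g γ : 𝓢(Rd d, ℂ))
    (w z : Rd d × Rd d) :
    ‖schwartzInner (phaseShift ħ w.1 w.2 g) (phaseShift ħ z.1 z.2 γ)‖ =
      normConst d ħ * ‖schwartzInner g (phaseShift ħ (z.1 - w.1) (z.2 - w.2) γ)‖ := by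
  rw [schwartzInner_phaseShift_phaseShift, norm_mul, norm_mul, norm_character, mul_one,
    Complex.norm_of_nonneg (normConst_pos d hħ).le]

theorem schwartzInner_self_ne_zero {g : 𝓢(Rd d, ℂ)} (hg : g ≠ 0) : schwartzInner g g ≠ 0 := by
  intro h
  apply hg
  have h1 : schwartzInner g g = ((∫ y, ‖g y‖ ^ 2 : ℝ) : ℂ) := by
    rw [← integral_complex_ofReal]
    refine integral_congr_ae (Eventually.of_forall fun y => ?_)
    simp [Complex.mul_conj']
  have hint : Integrable fun y => ‖g y‖ ^ 2 := by
    refine (mulS g (conjS g)).integrable.norm.congr (Eventually.of_forall fun y => ?_)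
    simp [sq]
  rw [h1, Complex.ofReal_eq_zero, integral_eq_zero_iff_of_nonneg (fun y => by positivity) hint] at h
  have h2 := (Continuous.ae_eq_iff_eq volume (g.continuous.norm.pow 2) continuous_const).1 h
  ext y
  have h3 : ‖g y‖ ^ 2 = 0 := congrFun h2 y
  simpa using h3

theorem conj_schwartzInner (g h : 𝓢(Rd d, ℂ)) :
    (starRingEnd ℂ) (schwartzInner g h) = schwartzInner h g := by
  rw [schwartzInner, ← integral_conj]
  refine integral_congr_ae (Eventually.of_forall fun y => ?_)
  simp [mul_comm]

/-! ### Continuity of the pairing and of Gabor transforms -/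

theorem continuous_schwartzInner_left (h : 𝓢(Rd d, ℂ)) :
    Continuous fun g : 𝓢(Rd d, ℂ) => schwartzInner g h := by
  have h1 : ∀ g : 𝓢(Rd d, ℂ), schwartzInner g h =
      SchwartzMap.integralCLM ℂ volume (mulS (conjS h) g) := by
    intro g
    rw [SchwartzMap.integralCLM_apply]
    simp [schwartzInner, mul_comm]
  simp only [h1]
  exact (ContinuousLinearMap.continuous _).comp (ContinuousLinearMap.continuous _)

theorem continuous_schwartzInner_right (g : 𝓢(Rd d, ℂ)) :
    Continuous fun h : 𝓢(Rd d, ℂ) => schwartzInner g h := by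
  simp only [← conj_schwartzInner _ g]
  exact Complex.continuous_conj.comp (continuous_schwartzInner_left g)

theorem continuous_conjS : Continuous (conjS (d := d)) :=
  (SchwartzMap.postcompCLM (𝕜 := ℝ) (Complex.conjCLE : ℂ →L[ℝ] ℂ)).continuous

theorem continuous_gabor {ħ : ℝ} (hħ : 0 < ħ) (g : 𝓢(Rd d, ℂ)) (T : 𝓢'(Rd d, ℂ)) :
    Continuous fun z : Rd d × Rd d => gabor ħ g T z.1 z.2 :=
  T.continuous.comp (continuous_conjS.comp (continuous_phaseShift hħ g))

theorem continuous_tempered_phaseShift {ħ : ℝ} (hħ : 0 < ħ) (g : 𝓢(Rd d, ℂ))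
    (T : 𝓢'(Rd d, ℂ)) : Continuous fun z : Rd d × Rd d => T (phaseShift ħ z.1 z.2 g) :=
  T.continuous.comp (continuous_phaseShift hħ g)

theorem continuous_schwartzInner_phaseShift {ħ : ℝ} (hħ : 0 < ħ) (ψ g : 𝓢(Rd d, ℂ)) :
    Continuous fun z : Rd d × Rd d => schwartzInner ψ (phaseShift ħ z.1 z.2 g) :=
  (continuous_schwartzInner_right ψ).comp (continuous_phaseShift hħ g)

theorem continuous_schwartzInner_phaseShift_phaseShift {ħ : ℝ} (hħ : 0 < ħ) (g γ : 𝓢(Rd d, ℂ)) :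
    Continuous fun p : (Rd d × Rd d) × (Rd d × Rd d) =>
      schwartzInner (phaseShift ħ p.1.1 p.1.2 g) (phaseShift ħ p.2.1 p.2.2 γ) := by
  simp only [schwartzInner_phaseShift_phaseShift]
  refine Continuous.mul ?_ (Continuous.comp (g := fun z : Rd d × Rd d =>
    schwartzInner g (phaseShift ħ z.1 z.2 γ))
    (f := fun p : (Rd d × Rd d) × (Rd d × Rd d) => (p.2.1 - p.1.1, p.2.2 - p.1.2))
    (continuous_schwartzInner_phaseShift hħ g γ) (by fun_prop))
  unfold character
  fun_prop

/-! ### The Gabor inversion formula -/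

theorem integrable_weight_prod :
    Integrable fun z : Rd d × Rd d => weight z.1 * weight z.2 :=
  integrable_weight.mul_prod integrable_weight

theorem exists_schwartzInner_phaseShift_le_weight {ħ : ℝ} (hħ : 0 < ħ) (ψ g : 𝓢(Rd d, ℂ)) (a : ℕ) :
    ∃ C : ℝ, 0 ≤ C ∧ ∀ x ξ, ‖schwartzInner ψ (phaseShift ħ x ξ g)‖ *
      ((1 + ‖x‖) ^ a * (1 + ‖ξ‖) ^ a) ≤ C * (weight x * weight ξ) := by
  obtain ⟨C, hC, h⟩ := exists_schwartzInner_phaseShift_le hħ ψ g (a + (d + 1))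
  refine ⟨C, hC, fun x ξ => ?_⟩
  rw [weight, weight, ← mul_inv, ← div_eq_mul_inv, le_div_iff₀ (by positivity)]
  refine le_trans (le_of_eq ?_) (h x ξ)
  ring

theorem continuous_schwartzInner_smul_phaseShift {ħ : ℝ} (hħ : 0 < ħ) (ψ g γ : 𝓢(Rd d, ℂ)) :
    Continuous fun z : Rd d × Rd d =>
      schwartzInner ψ (phaseShift ħ z.1 z.2 g) • phaseShift ħ z.1 z.2 γ :=
  (continuous_schwartzInner_phaseShift hħ ψ g).smul (continuous_phaseShift hħ γ)

/-- Seminorms of phase shifts grow polynomially, and the rapidly decaying coefficient beats any such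
growth. -/
theorem integrable_seminorm_schwartzInner_smul_phaseShift {ħ : ℝ} (hħ : 0 < ħ)
    (ψ g γ : 𝓢(Rd d, ℂ)) (k n : ℕ) : Integrable fun z : Rd d × Rd d =>
      SchwartzMap.seminorm ℂ k n
        (schwartzInner ψ (phaseShift ħ z.1 z.2 g) • phaseShift ħ z.1 z.2 γ) := by
  have hp := (schwartz_withSeminorms ℂ (Rd d) ℂ).continuous_seminorm (k, n)
  obtain ⟨a, C, hC, h1⟩ := exists_seminorm_phaseShift_le hħ γ hp
  obtain ⟨C', hC', h2⟩ := exists_schwartzInner_phaseShift_le_weight hħ ψ g a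
  refine (integrable_weight_prod.const_mul (C * C')).mono'
    (hp.comp (continuous_schwartzInner_smul_phaseShift hħ ψ g γ)).aestronglyMeasurable
    (Eventually.of_forall fun z => ?_)
  rw [Real.norm_of_nonneg (apply_nonneg _ _), map_smul_eq_mul]
  calc _ ≤ ‖schwartzInner ψ (phaseShift ħ z.1 z.2 g)‖ *
        (C * ((1 + ‖z.1‖) ^ a * (1 + ‖z.2‖) ^ a)) :=
        mul_le_mul_of_nonneg_left (h1 z.1 z.2) (norm_nonneg _)
    _ = C * (‖schwartzInner ψ (phaseShift ħ z.1 z.2 g)‖ *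
        ((1 + ‖z.1‖) ^ a * (1 + ‖z.2‖) ^ a)) := by ring
    _ ≤ C * (C' * (weight z.1 * weight z.2)) := mul_le_mul_of_nonneg_left (h2 z.1 z.2) hC
    _ = _ := by ring

/-- The inversion formula for the Gabor transform, pointwise on Schwartz functions. -/
theorem integral_schwartzInner_mul_phaseShift {ħ : ℝ} (hħ : 0 < ħ) (ψ g γ : 𝓢(Rd d, ℂ))
    (y : Rd d) : ∫ z : Rd d × Rd d,
      schwartzInner ψ (phaseShift ħ z.1 z.2 g) * phaseShift ħ z.1 z.2 γ y =
        schwartzInner γ g * ψ y := by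
  have hint : Integrable fun z : Rd d × Rd d =>
      schwartzInner ψ (phaseShift ħ z.1 z.2 g) * phaseShift ħ z.1 z.2 γ y := by
    refine (integrable_seminorm_schwartzInner_smul_phaseShift hħ ψ g γ 0 0).mono' ?_
      (Eventually.of_forall fun z => ?_)
    · have h := ((SchwartzMap.toBoundedContinuousFunctionCLM ℂ (Rd d) ℂ).continuous.comp
        (continuous_schwartzInner_smul_phaseShift hħ ψ g γ))
      exact ((continuous_eval_const y).comp h).aestronglyMeasurable
    · exact SchwartzMap.norm_le_seminorm ℂ
        (schwartzInner ψ (phaseShift ħ z.1 z.2 g) • phaseShift ħ z.1 z.2 γ) y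
  rw [Measure.volume_eq_prod] at hint ⊢
  rw [integral_prod _ hint]
  -- The integral over `ξ` is Fourier inversion at `y` for the windowed function; integrating the
  -- remaining `γ conj(g)` over `x` produces `⟨γ, g⟩`.
  have h1 : ∀ x, ∫ ξ, schwartzInner ψ (phaseShift ħ x ξ g) * phaseShift ħ x ξ γ y =
      ψ y * (γ (y - x) * (starRingEnd ℂ) (g (y - x))) := by
    intro x
    have h2 := integral_character_mul_fourierS hħ (mulS ψ (translate x (conjS g))) y
    simp only [mulS_apply, translate_apply, conjS_apply] at h2
    have h3 : ∀ ξ, schwartzInner ψ (phaseShift ħ x ξ g) * phaseShift ħ x ξ γ y =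
        (γ (y - x) * normConst d ħ : ℂ) *
          (character ħ ξ y * fourierS d hħ (mulS ψ (translate x (conjS g))) ξ) := by
      intro ξ
      rw [schwartzInner_phaseShift_eq_fourierS hħ, phaseShift_apply]
      ring
    simp only [h3]
    rw [integral_const_mul, mul_assoc, h2]
    ring
  simp only [h1]
  rw [integral_const_mul, integral_sub_left_eq_self
    (fun t => γ t * (starRingEnd ℂ) (g t)) volume y, mul_comm]
  rfl

/-- The inversion formula for the Gabor transform of a tempered distribution. -/
theorem integral_schwartzInner_mul_tempered {ħ : ℝ} (hħ : 0 < ħ) (T : 𝓢'(Rd d, ℂ))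
    (ψ g γ : 𝓢(Rd d, ℂ)) :
    Integrable (fun z : Rd d × Rd d =>
      schwartzInner ψ (phaseShift ħ z.1 z.2 g) * T (phaseShift ħ z.1 z.2 γ)) ∧
    ∫ z : Rd d × Rd d, schwartzInner ψ (phaseShift ħ z.1 z.2 g) * T (phaseShift ħ z.1 z.2 γ) =
      schwartzInner γ g * T ψ := by
  have h := integrable_and_integral_tempered (μ := (volume : Measure (Rd d × Rd d)))
    (continuous_schwartzInner_smul_phaseShift hħ ψ g γ)
    (integrable_seminorm_schwartzInner_smul_phaseShift hħ ψ g γ)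
    (G := schwartzInner γ g • ψ)
    (fun y => (integral_schwartzInner_mul_phaseShift hħ ψ g γ y).symm) T
  simpa only [map_smul, smul_eq_mul] using h

/-- The inversion formula for the Gabor transform of a tempered distribution. -/
theorem integral_gabor_mul_schwartzInner {ħ : ℝ} (hħ : 0 < ħ) (T : 𝓢'(Rd d, ℂ))
    (ψ g γ : 𝓢(Rd d, ℂ)) :
    ∫ z : Rd d × Rd d, gabor ħ g T z.1 z.2 * schwartzInner (phaseShift ħ z.1 z.2 γ) ψ =
      schwartzInner γ g * T (conjS ψ) := by
  -- Conjugate of the previous formula for `conj T`, with the two windows interchanged.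
  have h := congrArg (starRingEnd ℂ) (integral_schwartzInner_mul_tempered hħ (conjD T) ψ γ g).2
  rw [← integral_conj] at h
  simp only [map_mul, conjD_apply, Complex.conj_conj, conj_schwartzInner] at h
  rw [← h]
  refine integral_congr_ae (Eventually.of_forall fun z => ?_)
  simp only [gabor]
  ring

/-! ### Independence of the modulation space from the window -/

/-- The weight as a function with values in `[0, ∞]`. -/
def eweight (x : Rd d) : ℝ≥0∞ := ENNReal.ofReal (weight x)

theorem eweight_ne_top (x : Rd d) : eweight x ≠ ∞ := ENNReal.ofReal_ne_top

theorem measurable_eweight : Measurable (eweight (d := d)) :=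
  continuous_weight.measurable.ennreal_ofReal

theorem lintegral_eweight_lt_top : ∫⁻ x : Rd d, eweight x < ∞ :=
  integrable_weight.lintegral_lt_top

/-- The supremum is uncountable; it is measurable because a supremum of continuous functions is
lower semicontinuous. -/
theorem measurable_iSup_enorm {F : Rd d → Rd d → ℂ} (hF : ∀ x, Continuous (F x)) :
    Measurable fun ξ => ⨆ x, ‖F x ξ‖ₑ :=
  (lowerSemicontinuous_iSup fun x => (hF x).enorm.lowerSemicontinuous).measurable

theorem measurable_iSup_enorm_gabor {ħ : ℝ} (hħ : 0 < ħ) (g : 𝓢(Rd d, ℂ)) (T : 𝓢'(Rd d, ℂ)) :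
    Measurable fun ξ => ⨆ x, ‖gabor ħ g T x ξ‖ₑ :=
  measurable_iSup_enorm (F := fun x ξ => gabor ħ g T x ξ) fun x =>
    Continuous.comp (f := fun ξ => (x, ξ)) (continuous_gabor hħ g T) (by fun_prop)

/-- Off-diagonal decay of the Gabor matrix of two Schwartz functions. -/
theorem exists_enorm_schwartzInner_le {ħ : ℝ} (hħ : 0 < ħ) (g γ : 𝓢(Rd d, ℂ)) :
    ∃ K : ℝ≥0∞, K ≠ ∞ ∧ ∀ w z : Rd d × Rd d,
      ‖schwartzInner (phaseShift ħ w.1 w.2 g) (phaseShift ħ z.1 z.2 γ)‖ₑ ≤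
        K * (eweight (z.1 - w.1) * eweight (z.2 - w.2)) := by
  obtain ⟨C, hC, hdecay⟩ := exists_schwartzInner_phaseShift_le_weight hħ g γ 0
  have hnc := normConst_pos d hħ
  refine ⟨ENNReal.ofReal (normConst d ħ * C), ENNReal.ofReal_ne_top, fun w z => ?_⟩
  simp only [eweight]
  rw [← ENNReal.ofReal_mul (weight_pos _).le, ← ENNReal.ofReal_mul (by positivity),
    ← ofReal_norm]
  refine ENNReal.ofReal_le_ofReal ?_
  rw [norm_schwartzInner_phaseShift_phaseShift hħ, mul_assoc]
  refine mul_le_mul_of_nonneg_left ?_ hnc.le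
  simpa using hdecay (z.1 - w.1) (z.2 - w.2)

/-- Change of window in the Gabor transform: the pointwise bound. -/
theorem exists_enorm_gabor_le {ħ : ℝ} (hħ : 0 < ħ) {g₀ : 𝓢(Rd d, ℂ)} (hg₀ : g₀ ≠ 0)
    (g : 𝓢(Rd d, ℂ)) (T : 𝓢'(Rd d, ℂ)) : ∃ K : ℝ≥0∞, K ≠ ∞ ∧ ∀ x ξ, ‖gabor ħ g T x ξ‖ₑ ≤
      K * ∫⁻ η, (⨆ y, ‖gabor ħ g₀ T y η‖ₑ) * eweight (ξ - η) := by
  have hc := schwartzInner_self_ne_zero hg₀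
  obtain ⟨K₀, hK₀, hdecay⟩ := exists_enorm_schwartzInner_le hħ g₀ g
  let W : ℝ≥0∞ := ∫⁻ x : Rd d, eweight x
  have hW : W ≠ ∞ := lintegral_eweight_lt_top.ne
  refine ⟨‖schwartzInner g₀ g₀‖ₑ⁻¹ * (K₀ * W), ENNReal.mul_ne_top
    (ENNReal.inv_ne_top.2 (by simpa using hc)) (ENNReal.mul_ne_top hK₀ hW),
    fun x ξ => ?_⟩
  -- Expand with window `g₀`; the matrix decay in position integrates to a constant, leaving a
  -- convolution in frequency that does not depend on `x`.
  have hinv := integral_gabor_mul_schwartzInner hħ T (phaseShift ħ x ξ g) g₀ g₀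
  have hpt : ∀ z : Rd d × Rd d,
      ‖gabor ħ g₀ T z.1 z.2 * schwartzInner (phaseShift ħ z.1 z.2 g₀) (phaseShift ħ x ξ g)‖ₑ ≤
        K₀ * (eweight (x - z.1) * ((⨆ y, ‖gabor ħ g₀ T y z.2‖ₑ) * eweight (ξ - z.2))) := by
    intro z
    rw [enorm_mul]
    calc _ ≤ (⨆ y, ‖gabor ħ g₀ T y z.2‖ₑ) * (K₀ * (eweight (x - z.1) * eweight (ξ - z.2))) :=
          mul_le_mul' (le_iSup (fun y => ‖gabor ħ g₀ T y z.2‖ₑ) z.1)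
            (hdecay z (x, ξ))
      _ = _ := by ring
  have h3 : ‖schwartzInner g₀ g₀‖ₑ * ‖gabor ħ g T x ξ‖ₑ ≤
      (K₀ * W) * ∫⁻ η, (⨆ y, ‖gabor ħ g₀ T y η‖ₑ) * eweight (ξ - η) := by
    rw [← enorm_mul, gabor, ← hinv]
    refine (enorm_integral_le_lintegral_enorm _).trans ((lintegral_mono hpt).trans ?_)
    have hm1 : Measurable fun z : Rd d => eweight (x - z) :=
      measurable_eweight.comp (measurable_const_sub _)
    have hm2 : Measurable fun η : Rd d => (⨆ y, ‖gabor ħ g₀ T y η‖ₑ) * eweight (ξ - η) :=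
      (measurable_iSup_enorm_gabor hħ g₀ T).mul
        (measurable_eweight.comp (measurable_const_sub _))
    rw [lintegral_const_mul' _ _ hK₀, Measure.volume_eq_prod,
      lintegral_prod_mul hm1.aemeasurable hm2.aemeasurable,
      lintegral_sub_left_eq_self (fun t => eweight t) x, mul_assoc]
  rw [mul_assoc, ← ENNReal.div_eq_inv_mul,
    ENNReal.le_div_iff_mul_le (Or.inl (by simpa using hc)) (Or.inl enorm_ne_top), mul_comm]
  exact h3

/-- The modulation space norm is finite for all windows if it is finite for one. -/
theorem MemModulation.lintegral_lt_top {ħ : ℝ} (hħ : 0 < ħ) {T : 𝓢'(Rd d, ℂ)}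
    (hT : MemModulation ħ T) (g : 𝓢(Rd d, ℂ)) :
    ∫⁻ ξ : Rd d, ⨆ x : Rd d, ‖gabor ħ g T x ξ‖ₑ < ∞ := by
  obtain ⟨g₀, hg₀, hfin⟩ := hT
  obtain ⟨K, hK, hle⟩ := exists_enorm_gabor_le hħ hg₀ g T
  refine (lintegral_mono fun ξ => iSup_le fun x => hle x ξ).trans_lt ?_
  have hm := measurable_iSup_enorm_gabor hħ g₀ T
  -- By Tonelli, the convolution has integral equal to the product of the two integrals.
  rw [lintegral_const_mul' _ _ hK, lintegral_lintegral_swap]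
  · have h1 : ∀ η : Rd d, ∫⁻ ξ : Rd d, (⨆ y, ‖gabor ħ g₀ T y η‖ₑ) * eweight (ξ - η) =
        (⨆ y, ‖gabor ħ g₀ T y η‖ₑ) * ∫⁻ ξ : Rd d, eweight ξ := by
      intro η
      rw [lintegral_const_mul (f := fun ξ => eweight (ξ - η)) _
        (measurable_eweight.comp (measurable_sub_const η)),
        lintegral_sub_right_eq_self (fun t => eweight t) η]
    simp only [h1]
    rw [lintegral_mul_const _ hm]
    exact ENNReal.mul_lt_top hK.lt_top (ENNReal.mul_lt_top hfin lintegral_eweight_lt_top)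
  · exact ((hm.comp measurable_snd).mul
      (measurable_eweight.comp (measurable_fst.sub measurable_snd))).aemeasurable

/-! ### The integrable envelope of an element of `W^{∞,1}` -/

theorem conjS_phaseShift (ħ : ℝ) (x ξ : Rd d) (g : 𝓢(Rd d, ℂ)) :
    conjS (phaseShift ħ x ξ (conjS g)) = phaseShift ħ x (-ξ) g := by
  ext y
  simp [phaseShift_apply, conj_character]

/-- The function `x ↦ sup_ξ |f(π(x, ξ)γ)|`. -/
def supEnvelope (ħ : ℝ) (γ : 𝓢(Rd d, ℂ)) (f : 𝓢'(Rd d, ℂ)) (x : Rd d) : ℝ≥0∞ :=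
  ⨆ ξ : Rd d, ‖f (phaseShift ħ x ξ γ)‖ₑ

theorem enorm_le_supEnvelope (ħ : ℝ) (γ : 𝓢(Rd d, ℂ)) (f : 𝓢'(Rd d, ℂ)) (x ξ : Rd d) :
    ‖f (phaseShift ħ x ξ γ)‖ₑ ≤ supEnvelope ħ γ f x :=
  le_iSup (fun ξ => ‖f (phaseShift ħ x ξ γ)‖ₑ) ξ

theorem measurable_supEnvelope {ħ : ℝ} (hħ : 0 < ħ) (γ : 𝓢(Rd d, ℂ)) (f : 𝓢'(Rd d, ℂ)) :
    Measurable (supEnvelope ħ γ f) :=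
  measurable_iSup_enorm (F := fun ξ x => f (phaseShift ħ x ξ γ)) fun ξ =>
    Continuous.comp (f := fun x => (x, ξ)) (continuous_tempered_phaseShift hħ γ f) (by fun_prop)

/-- The Wiener amalgam norm of a distribution in `W^{∞,1}` is finite for all windows. -/
theorem MemWienerAmalgam.lintegral_supEnvelope_lt_top {ħ : ℝ} {hħ : 0 < ħ} {f : 𝓢'(Rd d, ℂ)}
    (hf : MemWienerAmalgam hħ f) (γ : 𝓢(Rd d, ℂ)) : ∫⁻ x, supEnvelope ħ γ f x < ∞ := by
  obtain ⟨h, hh, rfl⟩ := hf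
  refine lt_of_le_of_lt (lintegral_mono fun x => iSup_le fun ξ => ?_)
    (hh.lintegral_lt_top hħ (conjS (fourierS d hħ γ)))
  refine le_trans (le_of_eq ?_)
    (le_iSup (fun y => ‖gabor ħ (conjS (fourierS d hħ γ)) h y x‖ₑ) ξ)
  -- Up to a unimodular factor, `f(π(x, ξ)γ)` is `h(π(ξ, -x)𝓕γ)`, the Gabor transform of `h` at
  -- position `ξ` and frequency `x` with window `conj(𝓕γ)`.
  rw [fourierD_apply, fourierS_phaseShift, map_smul, gabor, conjS_phaseShift, enorm_smul,
    ← ofReal_norm (character ħ ξ x), norm_character]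
  simp

/-! ### The Gabor transform of the Fresnel function -/

/-- Expansion of the square: the cross term of `|u + x|²` is the character of frequency `x`. -/
theorem fresnelFun_add {ħ : ℝ} (hħ : 0 < ħ) (u x : Rd d) :
    fresnelFun d ħ (u + x) =
      Complex.exp ((‖x‖ ^ 2 / (2 * ħ) : ℝ) * Complex.I) * (character ħ x u * fresnelFun d ħ u) := by
  have h : (((‖u + x‖ ^ 2 / (2 * ħ) : ℝ) : ℂ)) * Complex.I =
      ((‖x‖ ^ 2 / (2 * ħ) : ℝ) : ℂ) * Complex.I + (((ħ⁻¹ * inner ℝ x u : ℝ) : ℂ) * Complex.I +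
        ((‖u‖ ^ 2 / (2 * ħ) : ℝ) : ℂ) * Complex.I) := by
    rw [← add_mul, ← add_mul, ← Complex.ofReal_add, ← Complex.ofReal_add, norm_add_sq_real,
      real_inner_comm]
    congr 2
    field_simp
    ring
  simp only [fresnelFun, character]
  rw [h, Complex.exp_add, Complex.exp_add]
  ring

/-- The Schwartz function `F₊ conj(g)`. -/
def fresnelWindow (ħ : ℝ) (g : 𝓢(Rd d, ℂ)) : 𝓢(Rd d, ℂ) :=
  SchwartzMap.smulLeftCLM ℂ (fresnelFun d ħ) (conjS g)

theorem fresnelWindow_apply (ħ : ℝ) (g : 𝓢(Rd d, ℂ)) (y : Rd d) :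
    fresnelWindow ħ g y = fresnelFun d ħ y * (starRingEnd ℂ) (g y) := by
  simp [fresnelWindow,
    SchwartzMap.smulLeftCLM_apply_apply (hasTemperateGrowth_fresnelFun d ħ)]

/-- The chirp has instantaneous frequency `x` at the point `x`, so only the deviation `ξ - x` from
the diagonal is seen by the modulus. -/
theorem norm_gabor_fresnelDist {ħ : ℝ} (hħ : 0 < ħ) (g : 𝓢(Rd d, ℂ)) (x ξ : Rd d) :
    ‖gabor ħ g (fresnelDist d ħ) x ξ‖ = ‖fourierS d hħ (fresnelWindow ħ g) (ξ - x)‖ := by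
  have h : gabor ħ g (fresnelDist d ħ) x ξ =
      (Complex.exp ((‖x‖ ^ 2 / (2 * ħ) : ℝ) * Complex.I) * character ħ (-ξ) x) *
        fourierS d hħ (fresnelWindow ħ g) (ξ - x) := by
    rw [gabor_fresnelDist, fourierS_apply_character, ← integral_add_right_eq_self _ x,
      ← mul_assoc, ← integral_const_mul]
    refine integral_congr_ae (Eventually.of_forall fun u => ?_)
    have e1 : -(ξ - x) = -ξ + x := by abel
    simp only [phaseShift_apply, fresnelFun_add hħ, fresnelWindow_apply, map_mul, conj_character,
      Complex.conj_ofReal, character_add_right, e1, character_add_left, add_sub_cancel_right]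
    ring
  rw [h, norm_mul, norm_mul, norm_character, Complex.norm_exp_ofReal_mul_I, one_mul, one_mul]

theorem exists_enorm_gabor_fresnelDist_le {ħ : ℝ} (hħ : 0 < ħ) (g : 𝓢(Rd d, ℂ)) :
    ∃ K : ℝ≥0∞, K ≠ ∞ ∧ ∀ x ξ, ‖gabor ħ g (fresnelDist d ħ) x ξ‖ₑ ≤ K * eweight (ξ - x) := by
  obtain ⟨C, hC, h⟩ := exists_norm_le_weight (fourierS d hħ (fresnelWindow ħ g))
  refine ⟨ENNReal.ofReal C, ENNReal.ofReal_ne_top, fun x ξ => ?_⟩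
  rw [eweight, ← ENNReal.ofReal_mul hC, ← ofReal_norm, norm_gabor_fresnelDist hħ]
  exact ENNReal.ofReal_le_ofReal (h _)

/-! ### Integrability of the phase space integrand -/

theorem measurable_eweight_sub :
    Measurable fun z : Rd d × Rd d => eweight (z.2 - z.1) :=
  measurable_eweight.comp (measurable_snd.sub measurable_fst)

theorem lintegral_eweight_sub_mul {H : Rd d → ℝ≥0∞} (hH : Measurable H) :
    ∫⁻ z : Rd d × Rd d, eweight (z.2 - z.1) * H z.1 = (∫⁻ x : Rd d, eweight x) * ∫⁻ x, H x := by
  rw [Measure.volume_eq_prod, lintegral_prod (fun z : Rd d × Rd d => eweight (z.2 - z.1) * H z.1)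
    (measurable_eweight_sub.mul (hH.comp measurable_fst)).aemeasurable, ← lintegral_const_mul _ hH]
  refine lintegral_congr fun x => ?_
  have hm : Measurable fun y : Rd d => eweight (y - x) :=
    measurable_eweight.comp (measurable_sub_const x)
  simp only
  rw [lintegral_mul_const _ hm, lintegral_sub_right_eq_self (fun t => eweight t) x]

theorem lintegral_lintegral_eweight_sub_mul {H : Rd d → ℝ≥0∞} (hH : Measurable H) :
    ∫⁻ x : Rd d, ∫⁻ y : Rd d, eweight (y - x) * H y = (∫⁻ x : Rd d, eweight x) * ∫⁻ x, H x := by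
  rw [lintegral_lintegral_swap
    (measurable_eweight_sub.mul (hH.comp measurable_snd)).aemeasurable, ← lintegral_const_mul _ hH]
  refine lintegral_congr fun y => ?_
  have hm : Measurable fun x : Rd d => eweight (y - x) :=
    measurable_eweight.comp (measurable_const_sub y)
  rw [lintegral_mul_const _ hm, lintegral_sub_left_eq_self (fun t => eweight t) y]

theorem continuous_phaseIntegrand {ħ : ℝ} (hħ : 0 < ħ) (g γ : 𝓢(Rd d, ℂ)) (f : 𝓢'(Rd d, ℂ)) :
    Continuous (phaseIntegrand ħ g γ f) := by
  have h : phaseIntegrand ħ g γ f = fun z => gabor ħ g (fresnelDist d ħ) z.1 z.2 *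
      f (phaseShift ħ z.1 z.2 γ) := by
    ext z
    rw [phaseIntegrand, conjGabor_eq]
  rw [h]
  exact (continuous_gabor hħ g _).mul (continuous_tempered_phaseShift hħ γ f)

theorem enorm_phaseIntegrand_le {ħ : ℝ} {g γ : 𝓢(Rd d, ℂ)} {K : ℝ≥0∞}
    (hK : ∀ x ξ, ‖gabor ħ g (fresnelDist d ħ) x ξ‖ₑ ≤ K * eweight (ξ - x)) {f : 𝓢'(Rd d, ℂ)}
    {H : Rd d → ℝ≥0∞} (hf : ∀ x ξ, ‖f (phaseShift ħ x ξ γ)‖ₑ ≤ H x) (z : Rd d × Rd d) :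
    ‖phaseIntegrand ħ g γ f z‖ₑ ≤ K * (eweight (z.2 - z.1) * H z.1) := by
  rw [phaseIntegrand, conjGabor_eq, enorm_mul, ← mul_assoc]
  exact mul_le_mul' (hK _ _) (hf _ _)

/-- Integrating in `ξ` first, the Fresnel factor contributes a constant, and `∫ H` remains. -/
theorem integrable_phaseIntegrand {ħ : ℝ} (hħ : 0 < ħ) (g γ : 𝓢(Rd d, ℂ)) {f : 𝓢'(Rd d, ℂ)}
    {H : Rd d → ℝ≥0∞} (hH : Measurable H) (hfin : ∫⁻ x, H x < ∞)
    (hf : ∀ x ξ, ‖f (phaseShift ħ x ξ γ)‖ₑ ≤ H x) : Integrable (phaseIntegrand ħ g γ f) := by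
  obtain ⟨K, hK, hle⟩ := exists_enorm_gabor_fresnelDist_le hħ g
  refine ⟨(continuous_phaseIntegrand hħ g γ f).aestronglyMeasurable, ?_⟩
  refine (lintegral_mono (enorm_phaseIntegrand_le hle hf)).trans_lt ?_
  rw [lintegral_const_mul' _ _ hK, lintegral_eweight_sub_mul hH]
  exact ENNReal.mul_lt_top hK.lt_top (ENNReal.mul_lt_top lintegral_eweight_lt_top hfin)

/-! ### Regularized distributions -/

theorem modulate_phaseShift (ħ : ℝ) (x ξ η : Rd d) (γ : 𝓢(Rd d, ℂ)) :
    modulate ħ η (phaseShift ħ x ξ γ) = phaseShift ħ x (ξ + η) γ := by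
  ext y
  simp only [modulate_apply, phaseShift_apply, character_add_left]
  ring

/-- Fourier inversion writes `φ(εy)` as a superposition of characters of frequency `εη`, each of
which moves `π(x, ξ)γ` in frequency only. -/
theorem regularize_phaseShift {ħ : ℝ} (hħ : 0 < ħ) (φ γ : 𝓢(Rd d, ℂ)) (ε : ℝ) (f : 𝓢'(Rd d, ℂ))
    (x ξ : Rd d) : regularize φ ε f (phaseShift ħ x ξ γ) =
      ∫ η, ((normConst d ħ : ℂ) * fourierS d hħ φ η) * f (phaseShift ħ x (ξ + ε • η) γ) := by
  let ψ := phaseShift ħ x ξ γ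
  let χ : 𝓢(Rd d, ℂ) := SchwartzMap.smulLeftCLM ℂ (fun y : Rd d => φ (ε • y)) ψ
  have hχ : ∀ y, χ y = φ (ε • y) * ψ y := fun y => by
    simp [χ, SchwartzMap.smulLeftCLM_apply_apply (hasTemperateGrowth_dilate φ ε)]
  let F : Rd d → 𝓢(Rd d, ℂ) := fun η =>
    ((normConst d ħ : ℂ) * fourierS d hħ φ η) • modulate ħ (ε • η) ψ
  have hF : Continuous F :=
    (continuous_const.mul (fourierS d hħ φ).continuous).smul
      ((continuous_modulate hħ ψ).comp (continuous_const_smul ε))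
  have hint : ∀ k n, Integrable fun η => SchwartzMap.seminorm ℂ k n (F η) := by
    intro k n
    have hp := (schwartz_withSeminorms ℂ (Rd d) ℂ).continuous_seminorm (k, n)
    obtain ⟨a, q, -, hq⟩ := polynomiallyBounded_modulate hħ _ hp
    refine ((integrable_one_add_norm_pow_mul (fourierS d hħ φ) a).const_mul
      (‖(normConst d ħ : ℂ)‖ * ((1 + |ε|) ^ a * q ψ))).mono'
      (hp.comp hF).aestronglyMeasurable (Eventually.of_forall fun η => ?_)
    rw [Real.norm_of_nonneg (apply_nonneg _ _), map_smul_eq_mul, norm_mul]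
    have h1 : (1 + ‖ε • η‖) ^ a ≤ (1 + |ε|) ^ a * (1 + ‖η‖) ^ a := by
      rw [← mul_pow, norm_smul, Real.norm_eq_abs]
      gcongr
      nlinarith [norm_nonneg η, abs_nonneg ε]
    have hq0 : 0 ≤ q ψ := apply_nonneg _ _
    calc _ ≤ ‖(normConst d ħ : ℂ)‖ * ‖fourierS d hħ φ η‖ * ((1 + ‖ε • η‖) ^ a * q ψ) :=
          mul_le_mul_of_nonneg_left (hq _ _) (by positivity)
      _ ≤ ‖(normConst d ħ : ℂ)‖ * ‖fourierS d hħ φ η‖ *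
          (((1 + |ε|) ^ a * (1 + ‖η‖) ^ a) * q ψ) := by gcongr
      _ = _ := by ring
  have hG : ∀ y, χ y = ∫ η, F η y := by
    intro y
    have h1 := integral_character_mul_fourierS hħ φ (ε • y)
    rw [hχ, ← h1, mul_assoc, ← integral_mul_const, ← integral_const_mul]
    refine integral_congr_ae (Eventually.of_forall fun η => ?_)
    simp only [F, smul_apply, smul_eq_mul, modulate_apply, character_smul_right]
    ring
  have h := (integrable_and_integral_tempered hF hint hG f).2
  rw [regularize_apply φ ε f ψ χ hχ, ← h]
  refine integral_congr_ae (Eventually.of_forall fun η => ?_)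
  simp only [F, ψ, map_smul, smul_eq_mul, modulate_phaseShift]

theorem measurable_enorm_fourierS {ħ : ℝ} (hħ : 0 < ħ) (φ : 𝓢(Rd d, ℂ)) :
    Measurable fun η => ‖(normConst d ħ : ℂ) * fourierS d hħ φ η‖ₑ :=
  (continuous_const.mul (fourierS d hħ φ).continuous).enorm.measurable

/-- The supremum over frequencies ignores the shift by `εη`, hence a bound uniform in `ε`. -/
theorem enorm_regularize_phaseShift_le {ħ : ℝ} (hħ : 0 < ħ) (φ γ : 𝓢(Rd d, ℂ)) (ε : ℝ)
    (f : 𝓢'(Rd d, ℂ)) (x ξ : Rd d) : ‖regularize φ ε f (phaseShift ħ x ξ γ)‖ₑ ≤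
      (∫⁻ η, ‖(normConst d ħ : ℂ) * fourierS d hħ φ η‖ₑ) * supEnvelope ħ γ f x := by
  rw [regularize_phaseShift hħ, ← lintegral_mul_const _ (measurable_enorm_fourierS hħ φ)]
  refine (enorm_integral_le_lintegral_enorm _).trans (lintegral_mono fun η => ?_)
  rw [enorm_mul]
  exact mul_le_mul_right (enorm_le_supEnvelope ħ γ f x _) _

theorem lintegral_enorm_fourierS_lt_top {ħ : ℝ} (hħ : 0 < ħ) (φ : 𝓢(Rd d, ℂ)) :
    ∫⁻ η, ‖(normConst d ħ : ℂ) * fourierS d hħ φ η‖ₑ < ∞ :=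
  ((fourierS d hħ φ).integrable.const_mul (normConst d ħ : ℂ)).2

/-- Dominated convergence with a dominating function with values in `[0, ∞]`. -/
theorem tendsto_integral_of_enorm_le {Z : Type*} [MeasurableSpace Z] {μ : Measure Z}
    {l : Filter ℝ} [l.IsCountablyGenerated] {F : ℝ → Z → ℂ} {f : Z → ℂ} {D : Z → ℝ≥0∞}
    (hD : Measurable D) (hfin : ∫⁻ z, D z ∂μ < ∞) (hF : ∀ ε, AEStronglyMeasurable (F ε) μ)
    (hle : ∀ ε z, ‖F ε z‖ₑ ≤ D z) (hlim : ∀ᵐ z ∂μ, Tendsto (fun ε => F ε z) l (𝓝 (f z))) :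
    Tendsto (fun ε => ∫ z, F ε z ∂μ) l (𝓝 (∫ z, f z ∂μ)) := by
  refine tendsto_integral_filter_of_dominated_convergence (fun z => (D z).toReal)
    (Eventually.of_forall hF) (Eventually.of_forall fun ε => ?_)
    (integrable_toReal_of_lintegral_ne_top hD.aemeasurable hfin.ne) hlim
  filter_upwards [ae_lt_top hD hfin.ne] with z hz
  rw [← toReal_enorm]
  exact ENNReal.toReal_mono hz.ne (hle ε z)

theorem tendsto_regularize_phaseShift {ħ : ℝ} (hħ : 0 < ħ) {φ : 𝓢(Rd d, ℂ)} (hφ : φ 0 = 1)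
    (γ : 𝓢(Rd d, ℂ)) (f : 𝓢'(Rd d, ℂ)) {x : Rd d} (hx : supEnvelope ħ γ f x < ∞) (ξ : Rd d) :
    Tendsto (fun ε : ℝ => regularize φ ε f (phaseShift ħ x ξ γ)) (𝓝[>] 0)
      (𝓝 (f (phaseShift ħ x ξ γ))) := by
  -- By Fourier inversion at the origin, `φ(0) = 1` says that the averaging density has total mass
  -- one.
  have h0 : ∫ η, ((normConst d ħ : ℂ) * fourierS d hħ φ η) * f (phaseShift ħ x ξ γ) =
      f (phaseShift ħ x ξ γ) := by
    have h1 := integral_character_mul_fourierS hħ φ 0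
    simp only [character, inner_zero_right, mul_zero, Complex.ofReal_zero, zero_mul,
      Complex.exp_zero, one_mul, hφ] at h1
    rw [integral_mul_const, integral_const_mul, h1, one_mul]
  have hcont : Continuous fun p : ℝ × Rd d => f (phaseShift ħ x (ξ + p.1 • p.2) γ) :=
    Continuous.comp (f := fun p : ℝ × Rd d => (x, ξ + p.1 • p.2))
      (continuous_tempered_phaseShift hħ γ f) (by fun_prop)
  simp only [regularize_phaseShift hħ]
  rw [← h0]
  have hm := (continuous_const.mul (fourierS d hħ φ).continuous :
    Continuous fun η => (normConst d ħ : ℂ) * fourierS d hħ φ η)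
  refine tendsto_integral_of_enorm_le
    (D := fun η => ‖(normConst d ħ : ℂ) * fourierS d hħ φ η‖ₑ * supEnvelope ħ γ f x)
    ((measurable_enorm_fourierS hħ φ).mul_const _) ?_ (fun ε => ?_) (fun ε η => ?_)
    (Eventually.of_forall fun η => ?_)
  · rw [lintegral_mul_const _ (measurable_enorm_fourierS hħ φ)]
    exact ENNReal.mul_lt_top (lintegral_enorm_fourierS_lt_top hħ φ) hx
  · exact (hm.mul (hcont.comp (Continuous.prodMk_right ε))).aestronglyMeasurable
  · rw [enorm_mul]
    exact mul_le_mul_right (enorm_le_supEnvelope ħ γ f x _) _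
  · have h2 := ((hcont.comp (Continuous.prodMk_left η)).tendsto 0).mono_left
      (nhdsWithin_le_nhds (s := Set.Ioi 0))
    simp only [Function.comp_apply, zero_smul, add_zero] at h2
    exact h2.const_mul _

/-! ### Independence of the windows -/

/-- Justifies Fubini. The weights form a chain: integrating out the frequency of `z`, the frequency
of `w`, then the position of `w` gives a constant each time and leaves the envelope. -/
theorem integrable_gabor_mul_schwartzInner_mul {ħ : ℝ} (hħ : 0 < ħ) (g γ g₀ γ₀ : 𝓢(Rd d, ℂ))
    {f : 𝓢'(Rd d, ℂ)} (hf : ∫⁻ x, supEnvelope ħ γ₀ f x < ∞) :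
    Integrable (fun p : (Rd d × Rd d) × (Rd d × Rd d) =>
      gabor ħ g (fresnelDist d ħ) p.1.1 p.1.2 *
        (schwartzInner (phaseShift ħ p.1.1 p.1.2 γ) (phaseShift ħ p.2.1 p.2.2 g₀) *
          f (phaseShift ħ p.2.1 p.2.2 γ₀))) := by
  obtain ⟨K₁, hK₁, hA⟩ := exists_enorm_gabor_fresnelDist_le hħ g
  obtain ⟨K₂, hK₂, hB⟩ := exists_enorm_schwartzInner_le hħ γ g₀
  let H := supEnvelope ħ γ₀ f
  have hH : Measurable H := measurable_supEnvelope hħ γ₀ f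
  let D : (Rd d × Rd d) × (Rd d × Rd d) → ℝ≥0∞ := fun p => eweight (p.1.2 - p.1.1) *
    ((eweight (p.2.1 - p.1.1) * H p.2.1) * eweight (p.2.2 - p.1.2))
  have hD : Measurable D := by
    have h1 := measurable_eweight (d := d)
    unfold D
    fun_prop
  have hle : ∀ p : (Rd d × Rd d) × (Rd d × Rd d), ‖gabor ħ g (fresnelDist d ħ) p.1.1 p.1.2 *
        (schwartzInner (phaseShift ħ p.1.1 p.1.2 γ) (phaseShift ħ p.2.1 p.2.2 g₀) *
          f (phaseShift ħ p.2.1 p.2.2 γ₀))‖ₑ ≤ (K₁ * K₂) * D p := by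
    intro p
    rw [enorm_mul, enorm_mul]
    calc _ ≤ (K₁ * eweight (p.1.2 - p.1.1)) *
          ((K₂ * (eweight (p.2.1 - p.1.1) * eweight (p.2.2 - p.1.2))) * H p.2.1) :=
          mul_le_mul' (hA _ _) (mul_le_mul' (hB p.1 p.2) (enorm_le_supEnvelope ħ γ₀ f _ _))
      _ = _ := by
        simp only [D]
        ring
  have hinner : ∀ w : Rd d × Rd d, ∫⁻ z : Rd d × Rd d, D (w, z) = (∫⁻ x : Rd d, eweight x) *
      (eweight (w.2 - w.1) * ∫⁻ y, eweight (y - w.1) * H y) := by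
    intro w
    have hm1 : Measurable fun y => eweight (y - w.1) * H y :=
      (measurable_eweight.comp (measurable_sub_const w.1)).mul hH
    have hm2 : Measurable fun y : Rd d => eweight (y - w.2) :=
      measurable_eweight.comp (measurable_sub_const w.2)
    simp only [D]
    rw [lintegral_const_mul' _ _ (eweight_ne_top _), Measure.volume_eq_prod,
      lintegral_prod_mul hm1.aemeasurable hm2.aemeasurable,
      lintegral_sub_right_eq_self (fun t => eweight t) w.2]
    ring
  have hmH : Measurable fun x => ∫⁻ y, eweight (y - x) * H y :=
    (measurable_eweight_sub.mul (hH.comp measurable_snd)).lintegral_prod_right'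
  refine ⟨Continuous.aestronglyMeasurable ?_, ?_⟩
  · exact ((continuous_gabor hħ g _).comp continuous_fst).mul
      ((continuous_schwartzInner_phaseShift_phaseShift hħ γ g₀).mul
        ((continuous_tempered_phaseShift hħ γ₀ f).comp continuous_snd))
  · refine (lintegral_mono hle).trans_lt ?_
    have hW := lintegral_eweight_lt_top (d := d)
    rw [lintegral_const_mul' _ _ (ENNReal.mul_ne_top hK₁ hK₂), Measure.volume_eq_prod,
      lintegral_prod _ hD.aemeasurable]
    simp only [hinner]
    rw [lintegral_const_mul' _ _ hW.ne, lintegral_eweight_sub_mul hmH,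
      lintegral_lintegral_eweight_sub_mul hH]
    exact ENNReal.mul_lt_top (ENNReal.mul_lt_top hK₁.lt_top hK₂.lt_top)
      (ENNReal.mul_lt_top hW (ENNReal.mul_lt_top hW (ENNReal.mul_lt_top hW hf)))

/-- Inversion for `f` expands `f(π(w)γ)` in the pair `g₀`, `γ₀`; after the exchange, the
`w`-integral is inversion for `F₊` with the pair `g`, `γ`, and returns `V_{g₀} F₊(z)`. -/
theorem schwartzInner_mul_integral_phaseIntegrand {ħ : ℝ} (hħ : 0 < ħ) (g γ g₀ γ₀ : 𝓢(Rd d, ℂ))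
    {f : 𝓢'(Rd d, ℂ)} (hf : ∫⁻ x, supEnvelope ħ γ₀ f x < ∞) :
    schwartzInner γ₀ g₀ * ∫ z, phaseIntegrand ħ g γ f z =
      schwartzInner γ g * ∫ z, phaseIntegrand ħ g₀ γ₀ f z := by
  rw [← integral_const_mul, ← integral_const_mul]
  have h1 : ∀ w : Rd d × Rd d, schwartzInner γ₀ g₀ * phaseIntegrand ħ g γ f w =
      ∫ z : Rd d × Rd d, gabor ħ g (fresnelDist d ħ) w.1 w.2 *
        (schwartzInner (phaseShift ħ w.1 w.2 γ) (phaseShift ħ z.1 z.2 g₀) *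
          f (phaseShift ħ z.1 z.2 γ₀)) := by
    intro w
    rw [integral_const_mul, (integral_schwartzInner_mul_tempered hħ f _ g₀ γ₀).2, phaseIntegrand,
      conjGabor_eq]
    ring
  have h2 : ∀ z : Rd d × Rd d, schwartzInner γ g * phaseIntegrand ħ g₀ γ₀ f z =
      ∫ w : Rd d × Rd d, gabor ħ g (fresnelDist d ħ) w.1 w.2 *
        (schwartzInner (phaseShift ħ w.1 w.2 γ) (phaseShift ħ z.1 z.2 g₀) *
          f (phaseShift ħ z.1 z.2 γ₀)) := by
    intro z
    simp only [← mul_assoc]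
    rw [integral_mul_const, integral_gabor_mul_schwartzInner hħ, phaseIntegrand, conjGabor_eq,
      gabor]
    ring
  simp only [h1, h2]
  exact integral_integral_swap (integrable_gabor_mul_schwartzInner_mul hħ g γ g₀ γ₀ hf)

theorem phasePairing_eq_phasePairing {ħ : ℝ} (hħ : 0 < ħ) {g γ g₀ γ₀ : 𝓢(Rd d, ℂ)}
    (h : schwartzInner γ g ≠ 0) (h₀ : schwartzInner γ₀ g₀ ≠ 0) {f : 𝓢'(Rd d, ℂ)}
    (hf : ∫⁻ x, supEnvelope ħ γ₀ f x < ∞) : phasePairing ħ g γ f = phasePairing ħ g₀ γ₀ f := by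
  have key := schwartzInner_mul_integral_phaseIntegrand hħ g γ g₀ γ₀ hf
  rw [phasePairing, phasePairing]
  field_simp
  linear_combination key

/-! ### Convergence of the regularized pairings -/

theorem integrable_phaseIntegrand_regularize {ħ : ℝ} (hħ : 0 < ħ) (φ g γ : 𝓢(Rd d, ℂ)) (ε : ℝ)
    {f : 𝓢'(Rd d, ℂ)} (hf : ∫⁻ x, supEnvelope ħ γ f x < ∞) :
    Integrable (phaseIntegrand ħ g γ (regularize φ ε f)) := by
  refine integrable_phaseIntegrand hħ g γ ((measurable_supEnvelope hħ γ f).const_mul _) ?_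
    (enorm_regularize_phaseShift_le hħ φ γ ε f)
  rw [lintegral_const_mul _ (measurable_supEnvelope hħ γ f)]
  exact ENNReal.mul_lt_top (lintegral_enorm_fourierS_lt_top hħ φ) hf

theorem tendsto_phasePairing_regularize {ħ : ℝ} (hħ : 0 < ħ) {φ : 𝓢(Rd d, ℂ)} (hφ : φ 0 = 1)
    (g γ : 𝓢(Rd d, ℂ)) {f : 𝓢'(Rd d, ℂ)} (hf : ∫⁻ x, supEnvelope ħ γ f x < ∞) :
    Tendsto (fun ε : ℝ => phasePairing ħ g γ (regularize φ ε f)) (𝓝[>] 0)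
      (𝓝 (phasePairing ħ g γ f)) := by
  obtain ⟨K, hK, hle⟩ := exists_enorm_gabor_fresnelDist_le hħ g
  have hm := measurable_supEnvelope hħ γ f
  let H : Rd d → ℝ≥0∞ := fun x =>
    (∫⁻ η, ‖(normConst d ħ : ℂ) * fourierS d hħ φ η‖ₑ) * supEnvelope ħ γ f x
  have hH : Measurable H := hm.const_mul _
  refine Tendsto.const_mul _ (tendsto_integral_of_enorm_le
    (D := fun z : Rd d × Rd d => K * (eweight (z.2 - z.1) * H z.1)) ?_ ?_
    (fun ε => (continuous_phaseIntegrand hħ g γ _).aestronglyMeasurable)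
    (fun ε z => enorm_phaseIntegrand_le hle (enorm_regularize_phaseShift_le hħ φ γ ε f) z) ?_)
  · exact (measurable_eweight_sub.mul (hH.comp measurable_fst)).const_mul _
  · rw [lintegral_const_mul' _ _ hK, lintegral_eweight_sub_mul hH, lintegral_const_mul _ hm]
    exact ENNReal.mul_lt_top hK.lt_top (ENNReal.mul_lt_top lintegral_eweight_lt_top
      (ENNReal.mul_lt_top (lintegral_enorm_fourierS_lt_top hħ φ) hf))
  · have hae : ∀ᵐ z : Rd d × Rd d, supEnvelope ħ γ f z.1 < ∞ :=
      Measure.quasiMeasurePreserving_fst.ae (ae_lt_top hm hf.ne)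
    filter_upwards [hae] with z hz
    simp only [phaseIntegrand, conjGabor_eq]
    exact (tendsto_regularize_phaseShift hħ hφ γ f hz z.2).const_mul _

end

end FresnelGabor

theorem theorem3p5 (d : ℕ) (ħ : ℝ) (hħ : 0 < ħ) (f : 𝓢'(FresnelGabor.Rd d, ℂ))
    (hf : FresnelGabor.MemWienerAmalgam hħ f) :
    ∃ I : ℂ, FresnelGabor.HasFresnelIntegral ħ f I ∧
      ∀ g γ : 𝓢(FresnelGabor.Rd d, ℂ), FresnelGabor.schwartzInner γ g ≠ 0 →
        Integrable (FresnelGabor.phaseIntegrand ħ g γ f) ∧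
        I = FresnelGabor.phasePairing ħ g γ f := by
  have hfin := fun γ => hf.lintegral_supEnvelope_lt_top γ
  -- The nonzero window that comes with membership in `M^{∞,1}` serves as the reference pair `g = γ
  -- = g₀` defining the value of the integral.
  have ⟨_, ⟨g₀, hg₀, _⟩, _⟩ := hf
  have h₀ := FresnelGabor.schwartzInner_self_ne_zero hg₀
  refine ⟨FresnelGabor.phasePairing ħ g₀ g₀ f, fun φ g γ hφ hγ => ⟨fun ε _ =>
    FresnelGabor.integrable_phaseIntegrand_regularize hħ φ g γ ε (hfin γ), ?_⟩, fun g γ hγ =>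
    ⟨FresnelGabor.integrable_phaseIntegrand hħ g γ (FresnelGabor.measurable_supEnvelope hħ γ f)
      (hfin γ) (FresnelGabor.enorm_le_supEnvelope ħ γ f),
    FresnelGabor.phasePairing_eq_phasePairing hħ h₀ hγ (hfin γ)⟩⟩
  rw [FresnelGabor.phasePairing_eq_phasePairing hħ h₀ hγ (hfin γ)]
  exact FresnelGabor.tendsto_phasePairing_regularize hħ hφ g γ (hfin γ)
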